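/- There is a universal constant $K>0$ such that the following holds. Let $X_1,X_2,\ldots$ be a homogeneous Markov chain (with arbitrary initial law) with values in a measurable space $(\mathcal S,\mathcal B)$ and transition kernel $P$. Assume the minorization condition: there are an integer $m\ge 1$, $\delta>0$, a set $C\in\mathcal B$ and a probability measure $\nu$ on $\mathcal S$ such that $P^m(x,A)\ge\delta\nu(A)$ for all $x\in C$ and $A\in\mathcal B$, and for every $x\in\mathcal S$ there is $k$ with $P^{km}(x,C)>0$. Assume that $P$ admits a stationary probability distribution $\pi$ (which is then unique). Assume further that the chain comes with a regenerative (split chain) representation, that is, that on the same probability space there are random variables $R_j\in\{0,1\}$ such that, putting $S_0=0$, $T_{i}=\inf\{k>0: R_{(S_{i-1}+k)m}=1\}$ and $S_i=T_1+\cdots+T_i$ for $i\ge1$: the $T_i$ are almost surely finite and independent, and $T_2,T_3,\ldots$ are identically distributed; the blocks $Y_0=(X_1,\ldots,X_{mT_1+m-1})$ and $Y_i=(X_{m(S_i+1)},\ldots,X_{mS_{i+1}+m-1})$, $i\ge 1$, are one-dependent (for every $i$, $\sigma((Y_j)_{j<i})$ and $\sigma((Y_j)_{j>i})$ are independent), and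 the sequence $Y_1,Y_2,\ldots$ is stationary. For a random variable $X$ let $\|X\|_{\psi_1}=\inf\{\lambda>0:\mathbb E(e^{|X|/\lambda}-1)\le1\}$, and assume $\|T_1\|_{\psi_1},\|T_2\|_{\psi_1}\le\tau$. Let $f\colon\mathcal S\to\mathbb R$ be measurable with $\sup_x|f(x)|\le a$ and $\int f\,d\pi=0$, and put $Z_1=\sum_{j=m(S_1+1)}^{mS_2+m-1}f(X_j)$. Then for all integers $n\ge2$ and all $t>0$, $$\mathbb P\Big(\Big|\sum_{i=1}^n f(X_i)\Big|>t\Big)\le K\exp\Big(-\frac1K\min\Big(\frac{t^2}{n\,(m\,\mathbb E T_2)^{-1}\,\mathrm{Var}\,Z_1},\ \frac{t}{\tau^2\,a\,m\log n}\Big)\Big),$$ with the conventions $s/0=\infty$ for $s>0$ and $e^{-\infty}=0$. -/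

import Mathlib

open MeasureTheory ProbabilityTheory
open scoped ENNReal

namespace RegenChain

noncomputable section

/-- The Orlicz norm `‖X‖_{ψ₁} = inf {c > 0 : E (exp (|X| / c) - 1) ≤ 1}`, with values in `[0, ∞]`
(it is `∞` when no such `c` exists). -/
def psiOneNorm {Ω : Type*} [MeasurableSpace Ω] (μ : Measure Ω) (X : Ω → ℝ) : ℝ≥0∞ :=
  sInf {r : ℝ≥0∞ | ∃ c : ℝ, 0 < c ∧ r = ENNReal.ofReal c ∧
    ∫⁻ ω, ENNReal.ofReal (Real.exp (|X ω| / c) - 1) ∂μ ≤ 1}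

/-- `X 1, X 2, …` is a homogeneous Markov chain with transition kernel `P` (and arbitrary initial
law), relative to its own filtration `σ(X 1, …, X n)`. The index `0` is not used. -/
structure IsMarkovChain {Ω S : Type*} [MeasurableSpace Ω] [MeasurableSpace S]
    (μ : Measure Ω) (P : Kernel S S) (X : ℕ → Ω → S) : Prop where
  measurable : ∀ n, Measurable (X n)
  markov : ∀ n, 1 ≤ n → ∀ A : Set S, MeasurableSet A →
    μ⟦X (n + 1) ⁻¹' A | ⨆ i ∈ Finset.Icc 1 n, MeasurableSpace.comap (X i) inferInstance⟧
      =ᵐ[μ] fun ω => (P (X n ω)).real A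

/-- The minorization condition with parameters `m`, `δ`, small set `C` and probability measure
`ν`. Here `P ^ k` is the `k`-step transition kernel. -/
structure Minorization {S : Type*} [MeasurableSpace S] (P : Kernel S S)
    (m : ℕ) (δ : ℝ) (C : Set S) (ν : Measure S) : Prop where
  m_pos : 0 < m
  δ_pos : 0 < δ
  measurableSet : MeasurableSet C
  isProbabilityMeasure : IsProbabilityMeasure ν
  minorize : ∀ x ∈ C, ∀ A : Set S, MeasurableSet A → ENNReal.ofReal δ * ν A ≤ (P ^ m) x A
  access : ∀ x : S, ∃ n : ℕ, 0 < (P ^ (n * m)) x C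

section Times

variable {Ω : Type*} (m : ℕ) (R : ℕ → Ω → Fin 2)

/-- `inf {n > 0 : R_{(s + n) m} = 1}`. -/
def waitFrom (s : ℕ) (ω : Ω) : ℕ := sInf {n : ℕ | 0 < n ∧ R ((s + n) * m) ω = 1}

/-- `S_i = T_1 + ⋯ + T_i`, where `T_{i+1} = inf {n > 0 : R_{(S_i + n) m} = 1}`. -/
def regenSum : ℕ → Ω → ℕ
  | 0, _ => 0
  | i + 1, ω => regenSum i ω + waitFrom m R (regenSum i ω) ω

/-- The regeneration times `T_i`, `i ≥ 1` (the value at `i = 0` is a dummy). -/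
def regenTime : ℕ → Ω → ℕ
  | 0, _ => 0
  | i + 1, ω => waitFrom m R (regenSum m R i ω) ω

end Times

/-- The finite word `(X_u, X_{u+1}, …, X_v)`, as an element of the space of words of all lengths,
which carries the disjoint-union σ-algebra. -/
def word {Ω S : Type*} (X : ℕ → Ω → S) (u v : ℕ) (ω : Ω) : Σ k : ℕ, (Fin k → S) :=
  ⟨v + 1 - u, fun j => X (u + j) ω⟩

/-- The blocks `Y_0 = (X_1, …, X_{m T_1 + m - 1})` and
`Y_i = (X_{m (S_i + 1)}, …, X_{m S_{i+1} + m - 1})` for `i > 0`. -/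
def block {Ω S : Type*} (m : ℕ) (R : ℕ → Ω → Fin 2) (X : ℕ → Ω → S) :
    ℕ → Ω → Σ k : ℕ, (Fin k → S)
  | 0, ω => word X 1 (m * regenTime m R 1 ω + m - 1) ω
  | i + 1, ω =>
      word X (m * (regenSum m R (i + 1) ω + 1)) (m * regenSum m R (i + 2) ω + m - 1) ω

/-- The block sums `Z_i(f)`: the sum of `f(X_j)` over `m (S_i + 1) ≤ j ≤ m S_{i+1} + m - 1`,
for `i ≥ 1`. -/
def blockSum {Ω S : Type*} (m : ℕ) (R : ℕ → Ω → Fin 2) (X : ℕ → Ω → S) (f : S → ℝ)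
    (i : ℕ) (ω : Ω) : ℝ :=
  ∑ j ∈ Finset.Icc (m * (regenSum m R i ω + 1)) (m * regenSum m R (i + 1) ω + m - 1), f (X j ω)

/-- `(X_n, R_n)` with `R_n ∈ {0, 1}` is a regenerative (split chain) representation of the Markov
chain `X` with kernel `P`: the regeneration times are almost surely well defined and independent,
`T_2, T_3, …` are identically distributed, and the blocks form a one-dependent sequence,
stationary from `Y_1` on. -/
structure IsRegenerative {Ω S : Type*} [MeasurableSpace Ω] [MeasurableSpace S]
    (μ : Measure Ω) (P : Kernel S S) (m : ℕ) (X : ℕ → Ω → S) (R : ℕ → Ω → Fin 2) : Prop where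
  isMarkovChain : IsMarkovChain μ P X
  measurable_R : ∀ n, Measurable (R n)
  wellDefined : ∀ᵐ ω ∂μ, ∀ N : ℕ, ∃ k : ℕ, N < k ∧ R (k * m) ω = 1
  indep_times : iIndepFun (fun i : ℕ => regenTime m R (i + 1)) μ
  identDistrib_times : ∀ i : ℕ, 2 ≤ i → IdentDistrib (regenTime m R i) (regenTime m R 2) μ μ
  oneDependent : ∀ i : ℕ, Indep
    (⨆ j : {j : ℕ // j < i}, MeasurableSpace.comap (block m R X j) inferInstance)
    (⨆ j : {j : ℕ // i < j}, MeasurableSpace.comap (block m R X j) inferInstance) μ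
  stationary_blocks : IdentDistrib (fun ω (i : ℕ) => block m R X (i + 1) ω)
    (fun ω (i : ℕ) => block m R X (i + 2) ω) μ μ

/-- `min (t² / v, t / b)` for `t > 0` and `v, b ≥ 0`, with the convention `t / 0 = ∞`. -/
def tailExponent (t v b : ℝ) : ℝ≥0∞ :=
  min (ENNReal.ofReal (t ^ 2) / ENNReal.ofReal v) (ENNReal.ofReal t / ENNReal.ofReal b)

end

end RegenChain

namespace RegenChain

/-! Regeneration cuts the trajectory into blocks: the sum up to time `n` consists of the first
block, a random number of full block sums and a piece of the current block. The two boundary pieces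
are bounded by `a * m` times regeneration times, whose exponential moments control them. By time `n`
the current block has index at most `L`, about `2n / (m E T₂)`, outside an event estimated by the
lower tail of a sum of independent times (`measure_sum_le_half_mean`). Because the number of full
blocks is random, a maximal inequality is needed: one-dependence makes every other block sum
independent of its predecessors of the same parity, so Doob's inequality applies to an exponential
submartingale (`measure_exists_sum_gt_le`).

The true variance of `Z₁` survives because `integral_exp_mul_le` expands the exponential moment at
scale `a * m * c * H`, with `c` the exponential scale of the times, at the price of an error `exp
(-H)`. With `H = log n` these errors, summed over `L ≤ 3n` blocks, stay bounded; this is the source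
of the logarithm. The factor `τ²` pays for the block-counting event. All this is combined in
`measure_abs_sum_gt_le`, for centred block sums.

It remains to see that `E Z₁ = 0`. This expectation is the integral of `f` against the occupation
measure of the first full block. To prove that measure invariant, the tail bound itself is applied
to `P 1_A - 1_A - r`, with `r` chosen to centre the block sum: its time averages tend to `0` in
mean, while telescoping shows that they tend to `-r`. Hence `r = 0` (`invariant_occupation`), and
uniqueness (`Minorization.invariant_unique`) makes the occupation measure a multiple of `π`. -/

/-- The sum of `f` over the letters of a word. -/
def wordSum {S : Type*} (f : S → ℝ) (w : Σ k : ℕ, (Fin k → S)) : ℝ := ∑ j, f (w.2 j)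

/-! ### Measurability of regeneration times, blocks and word sums. -/

section Measurability

variable {Ω S : Type*} [MeasurableSpace Ω] [MeasurableSpace S]

theorem measurable_waitFrom {m : ℕ} {R : ℕ → Ω → Fin 2} (hR : ∀ n, Measurable (R n)) (s : ℕ) :
    Measurable (waitFrom m R s) := by
  have hset : ∀ n, MeasurableSet {ω | R ((s + n) * m) ω = 1} := fun n =>
    hR _ (measurableSet_singleton (1 : Fin 2))
  refine measurable_of_Iic fun k => ?_
  -- Paths that never regenerate after `s` have waiting time `sInf ∅ = 0`, so they belong to every
  -- such preimage.
  have : waitFrom m R s ⁻¹' Set.Iic k =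
      {ω | ∀ n, 0 < n → R ((s + n) * m) ω ≠ 1} ∪
        {ω | ∃ n, (0 < n ∧ n ≤ k) ∧ R ((s + n) * m) ω = 1} := by
    ext ω
    simp only [Set.mem_preimage, Set.mem_Iic, Set.mem_union, Set.mem_ofPred_eq, waitFrom]
    rcases Set.eq_empty_or_nonempty {n : ℕ | 0 < n ∧ R ((s + n) * m) ω = 1} with h | h
    · rw [h]
      simp only [Nat.sInf_empty, zero_le, true_iff]
      exact Or.inl fun n hn hn1 => (h.subset ⟨hn, hn1⟩).elim
    · constructor
      · intro hk
        exact Or.inr ⟨_, ⟨(Nat.sInf_mem h).1, hk⟩, (Nat.sInf_mem h).2⟩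
      · rintro (h' | ⟨n, hn, hn1⟩)
        · obtain ⟨n, hn, hn1⟩ := h
          exact (h' n hn hn1).elim
        · exact (Nat.sInf_le (show n ∈ {n : ℕ | 0 < n ∧ R ((s + n) * m) ω = 1} from
            ⟨hn.1, hn1⟩)).trans hn.2
  rw [this]
  refine MeasurableSet.union ?_ ?_
  · simp only [Set.ofPred_forall]
    exact MeasurableSet.iInter fun n => MeasurableSet.iInter fun _ => (hset n).compl
  · simp only [Set.ofPred_exists, Set.ofPred_and]
    exact MeasurableSet.iUnion fun n => ((MeasurableSet.const _).inter (MeasurableSet.const _)).inter (hset n)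

theorem measurable_regenSum {m : ℕ} {R : ℕ → Ω → Fin 2} (hR : ∀ n, Measurable (R n)) (i : ℕ) :
    Measurable (regenSum m R i) := by
  induction i with
  | zero => exact measurable_const
  | succ i ih =>
    have h : Measurable fun p : ℕ × Ω => waitFrom m R p.1 p.2 :=
      measurable_from_prod_countable_right fun s => measurable_waitFrom hR s
    exact ih.add (h.comp (ih.prodMk measurable_id))

theorem measurable_regenTime {m : ℕ} {R : ℕ → Ω → Fin 2} (hR : ∀ n, Measurable (R n)) (i : ℕ) :
    Measurable (regenTime m R i) := by
  cases i with
  | zero => exact measurable_const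
  | succ i =>
    have h : Measurable fun p : ℕ × Ω => waitFrom m R p.1 p.2 :=
      measurable_from_prod_countable_right fun s => measurable_waitFrom hR s
    exact h.comp ((measurable_regenSum hR i).prodMk measurable_id)

theorem measurable_sigmaMk (k : ℕ) :
    Measurable fun x : Fin k → S => (⟨k, x⟩ : Σ k : ℕ, (Fin k → S)) :=
  fun _ hs => MeasurableSpace.measurableSet_iInf.1 hs k

theorem measurable_word {X : ℕ → Ω → S} (hX : ∀ n, Measurable (X n)) {u v : Ω → ℕ}
    (hu : Measurable u) (hv : Measurable v) : Measurable fun ω => word X (u ω) (v ω) ω := by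
  have h : Measurable fun p : (ℕ × ℕ) × Ω => word X p.1.1 p.1.2 p.2 :=
    measurable_from_prod_countable_right fun p =>
      (measurable_sigmaMk (p.2 + 1 - p.1)).comp
        (measurable_pi_lambda (fun ω (j : Fin (p.2 + 1 - p.1)) => X (p.1 + j) ω) fun j => hX _)
  exact h.comp ((hu.prodMk hv).prodMk measurable_id)

theorem measurable_block {m : ℕ} {R : ℕ → Ω → Fin 2} {X : ℕ → Ω → S}
    (hX : ∀ n, Measurable (X n)) (hR : ∀ n, Measurable (R n)) (i : ℕ) :
    Measurable (block m R X i) := by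
  have hT := fun i => measurable_regenTime (m := m) hR i
  have hS := fun i => measurable_regenSum (m := m) hR i
  cases i with
  | zero =>
    exact measurable_word hX measurable_const
      ((measurable_of_countable fun k : ℕ => m * k + m - 1).comp (hT 1))
  | succ i =>
    exact measurable_word hX ((measurable_of_countable fun k : ℕ => m * (k + 1)).comp (hS (i + 1)))
      ((measurable_of_countable fun k : ℕ => m * k + m - 1).comp (hS (i + 2)))

theorem measurable_wordSum {f : S → ℝ} (hf : Measurable f) : Measurable (wordSum f) := by
  intro s hs
  refine MeasurableSpace.measurableSet_iInf.2 fun k => ?_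
  have : Measurable fun x : Fin k → S => ∑ j, f (x j) :=
    Finset.measurable_sum _ fun j _ => hf.comp (measurable_pi_apply j)
  exact this hs

end Measurability

/-! ### Pathwise block decomposition of partial sums. -/

section Pathwise

variable {Ω S : Type*} {m : ℕ} {R : ℕ → Ω → Fin 2} {ω : Ω}

theorem blockSum_eq_wordSum (m : ℕ) (R : ℕ → Ω → Fin 2) (X : ℕ → Ω → S) (f : S → ℝ) (i : ℕ) :
    blockSum m R X f (i + 1) = wordSum f ∘ block m R X (i + 1) := by
  funext ω
  have key : ∀ u v : ℕ, ∑ j ∈ Finset.Icc u v, f (X j ω) = wordSum f (word X u v ω) := by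
    intro u v
    have : Finset.Icc u v = Finset.Ico u (v + 1) := by ext; simp
    rw [this, Finset.sum_Ico_eq_sum_range, ← Fin.sum_univ_eq_sum_range (fun j => f (X (u + j) ω))]
    rfl
  exact key _ _

theorem waitFrom_pos (hω : ∀ N : ℕ, ∃ k : ℕ, N < k ∧ R (k * m) ω = 1) (s : ℕ) :
    0 < waitFrom m R s ω := by
  have : {n : ℕ | 0 < n ∧ R ((s + n) * m) ω = 1}.Nonempty := by
    obtain ⟨k, hk, hk1⟩ := hω s
    exact ⟨k - s, by omega, by rwa [Nat.add_sub_cancel' hk.le]⟩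
  exact (Nat.sInf_mem this).1

theorem regenTime_pos (hω : ∀ N : ℕ, ∃ k : ℕ, N < k ∧ R (k * m) ω = 1) (i : ℕ) :
    0 < regenTime m R (i + 1) ω := waitFrom_pos hω _

theorem regenSum_succ (m : ℕ) (R : ℕ → Ω → Fin 2) (i : ℕ) (ω : Ω) :
    regenSum m R (i + 1) ω = regenSum m R i ω + regenTime m R (i + 1) ω := rfl

theorem regenSum_eq_sum (m : ℕ) (R : ℕ → Ω → Fin 2) (i : ℕ) (ω : Ω) :
    regenSum m R i ω = ∑ j ∈ Finset.range i, regenTime m R (j + 1) ω := by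
  induction i with
  | zero => rfl
  | succ i ih => rw [regenSum_succ, Finset.sum_range_succ, ih]

/-- In half-open form the right endpoint of a block is the left endpoint of the next, so consecutive
blocks tile the time axis. Positivity of `m` makes the truncated `- 1` harmless. -/
theorem blockSum_eq_sum_Ico (hm : 0 < m) (X : ℕ → Ω → S) (f : S → ℝ) (i : ℕ) :
    blockSum m R X f i ω =
      ∑ j ∈ Finset.Ico (m * (regenSum m R i ω + 1)) (m * (regenSum m R (i + 1) ω + 1)),
        f (X j ω) := by
  have h : Finset.Icc (m * (regenSum m R i ω + 1)) (m * regenSum m R (i + 1) ω + m - 1) =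
      Finset.Ico (m * (regenSum m R i ω + 1)) (m * (regenSum m R (i + 1) ω + 1)) := by
    ext j
    simp only [Finset.mem_Icc, Finset.mem_Ico, mul_add, mul_one]
    omega
  rw [blockSum, h]

theorem abs_sum_Ico_le {X : ℕ → Ω → S} {f : S → ℝ} {a : ℝ} (hf : ∀ x, |f x| ≤ a) (u v : ℕ) :
    |∑ j ∈ Finset.Ico u v, f (X j ω)| ≤ a * (v - u : ℕ) := by
  refine (Finset.abs_sum_le_sum_abs _ _).trans ?_
  refine (Finset.sum_le_card_nsmul _ _ a fun j _ => hf _).trans ?_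
  simp [mul_comm]

theorem mul_regenSum_sub (m : ℕ) (R : ℕ → Ω → Fin 2) (i : ℕ) (ω : Ω) :
    m * (regenSum m R (i + 1) ω + 1) - m * (regenSum m R i ω + 1) =
      m * regenTime m R (i + 1) ω := by
  rw [regenSum_succ, ← Nat.mul_sub]
  congr 1
  omega

theorem blockSum_sub (m : ℕ) (R : ℕ → Ω → Fin 2) (X : ℕ → Ω → S) (f g : S → ℝ) (i : ℕ) (ω : Ω) :
    blockSum m R X (fun x => f x - g x) i ω = blockSum m R X f i ω - blockSum m R X g i ω :=
  Finset.sum_sub_distrib _ _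

theorem blockSum_const (hm : 0 < m) (X : ℕ → Ω → S) (r : ℝ) (i : ℕ) (ω : Ω) :
    blockSum m R X (fun _ => r) i ω = r * (m * regenTime m R (i + 1) ω) := by
  rw [blockSum_eq_sum_Ico hm, Finset.sum_const, Nat.card_Ico, nsmul_eq_mul]
  rw [mul_regenSum_sub]
  push_cast
  ring

theorem abs_blockSum_le (hm : 0 < m) {X : ℕ → Ω → S} {f : S → ℝ} {a : ℝ} (hf : ∀ x, |f x| ≤ a)
    (i : ℕ) : |blockSum m R X f i ω| ≤ a * m * regenTime m R (i + 1) ω := by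
  rw [blockSum_eq_sum_Ico hm]
  refine (abs_sum_Ico_le hf _ _).trans (le_of_eq ?_)
  rw [mul_regenSum_sub]
  push_cast
  ring

theorem sum_Ico_one_eq (hm : 0 < m) (X : ℕ → Ω → S) (f : S → ℝ) (k : ℕ) :
    ∑ j ∈ Finset.Ico 1 (m * (regenSum m R (k + 1) ω + 1)), f (X j ω) =
      ∑ j ∈ Finset.Ico 1 (m * (regenSum m R 1 ω + 1)), f (X j ω) +
        ∑ i ∈ Finset.range k, blockSum m R X f (i + 1) ω := by
  induction k with
  | zero => simp
  | succ k ih =>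
    rw [Finset.sum_range_succ, ← add_assoc, ← ih, blockSum_eq_sum_Ico hm,
      Finset.sum_Ico_consecutive]
    · exact Nat.mul_pos hm (Nat.succ_pos _)
    · rw [regenSum_succ m R (k + 1)]
      gcongr
      omega

/-- Up to the first and the current block, a partial sum of the chain is a partial sum of
block sums. -/
theorem exists_abs_sum_le (hm : 0 < m) {X : ℕ → Ω → S} {f : S → ℝ} {a : ℝ}
    (hf : ∀ x, |f x| ≤ a) (n L : ℕ)
    (hL : n < m * (regenSum m R (L + 1) ω + 1)) :
    ∃ k ≤ L, |∑ j ∈ Finset.Icc 1 n, f (X j ω)| ≤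
      a * m * (regenTime m R 1 ω + 1) + a * m * regenTime m R (k + 1) ω +
        |∑ i ∈ Finset.range (k - 1), blockSum m R X f (i + 1) ω| := by
  classical
  have ha : 0 ≤ a := (abs_nonneg _).trans (hf (X 0 ω))
  have hex : ∃ k, n < m * (regenSum m R (k + 1) ω + 1) := ⟨L, hL⟩
  have hIcc : Finset.Icc 1 n = Finset.Ico 1 (n + 1) := by ext; simp
  have hS1 : regenSum m R 1 ω = regenTime m R 1 ω := by
    rw [regenSum_succ]; exact zero_add _
  rw [hIcc]
  -- The witness is the index of the block containing `n`. If it is `0`, the truncated `k - 1` gives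
  -- an empty sum, as it should.
  refine ⟨Nat.find hex, Nat.find_min' hex hL, ?_⟩
  have hk := Nat.find_spec hex
  rcases hk0 : Nat.find hex with _ | k
  · rw [hk0] at hk
    refine (abs_sum_Ico_le hf _ _).trans ?_
    have h1 : ((n + 1 - 1 : ℕ) : ℝ) ≤ m * (regenTime m R 1 ω + 1) := by
      rw [zero_add, hS1] at hk
      have := hk.le
      rw [Nat.add_sub_cancel]
      exact_mod_cast this
    have h2 : 0 ≤ a * m * (regenTime m R 1 ω : ℝ) := by positivity
    calc a * ((n + 1 - 1 : ℕ) : ℝ) ≤ a * (m * (regenTime m R 1 ω + 1)) := by gcongr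
      _ ≤ _ := by
        have := abs_nonneg (∑ i ∈ Finset.range (0 - 1), blockSum m R X f (i + 1) ω)
        simp only [zero_add]
        linarith
  · have hmin : m * (regenSum m R (k + 1) ω + 1) ≤ n :=
      not_lt.1 (Nat.find_min hex (by omega : k < Nat.find hex))
    rw [hk0] at hk
    have h1 : 1 ≤ m * (regenSum m R (k + 1) ω + 1) := Nat.mul_pos hm (Nat.succ_pos _)
    rw [← Finset.sum_Ico_consecutive _ h1 (by omega : m * (regenSum m R (k + 1) ω + 1) ≤ n + 1),
      sum_Ico_one_eq hm, Nat.add_sub_cancel]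
    have hA : |∑ j ∈ Finset.Ico 1 (m * (regenSum m R 1 ω + 1)), f (X j ω)| ≤
        a * m * (regenTime m R 1 ω + 1) := by
      refine (abs_sum_Ico_le hf _ _).trans ?_
      rw [mul_assoc, hS1]
      gcongr
      have : m * (regenTime m R 1 ω + 1) - 1 ≤ m * (regenTime m R 1 ω + 1) := Nat.sub_le _ _
      exact_mod_cast this
    have hB : |∑ j ∈ Finset.Ico (m * (regenSum m R (k + 1) ω + 1)) (n + 1), f (X j ω)| ≤
        a * m * regenTime m R (k + 1 + 1) ω := by
      refine (abs_sum_Ico_le hf _ _).trans ?_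
      rw [mul_assoc]
      gcongr
      have : n + 1 - m * (regenSum m R (k + 1) ω + 1) ≤ m * regenTime m R (k + 1 + 1) ω := by
        rw [regenSum_succ m R (k + 1)] at hk
        have e : m * (regenSum m R (k + 1) ω + regenTime m R (k + 1 + 1) ω + 1) =
          m * (regenSum m R (k + 1) ω + 1) + m * regenTime m R (k + 1 + 1) ω := by ring
        omega
      exact_mod_cast this
    have e1 := abs_add_le (∑ j ∈ Finset.Ico 1 (m * (regenSum m R 1 ω + 1)), f (X j ω) +
      ∑ i ∈ Finset.range k, blockSum m R X f (i + 1) ω)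
      (∑ j ∈ Finset.Ico (m * (regenSum m R (k + 1) ω + 1)) (n + 1), f (X j ω))
    have e2 := abs_add_le (∑ j ∈ Finset.Ico 1 (m * (regenSum m R 1 ω + 1)), f (X j ω))
      (∑ i ∈ Finset.range k, blockSum m R X f (i + 1) ω)
    linarith

/-- Separates the two parity classes, since adjacent blocks may be dependent. -/
theorem sum_range_eq_odd_add_even (z : ℕ → ℝ) (k : ℕ) :
    ∑ i ∈ Finset.range k, z i = ∑ j ∈ Finset.range ((k + 1) / 2), z (2 * j) +
      ∑ j ∈ Finset.range (k / 2), z (2 * j + 1) := by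
  induction k with
  | zero => simp
  | succ k ih =>
    rw [Finset.sum_range_succ, ih]
    rcases Nat.even_or_odd' k with ⟨r, rfl | rfl⟩
    · have h1 : (2 * r + 1) / 2 = r := by omega
      have h2 : (2 * r + 1 + 1) / 2 = r + 1 := by omega
      have h3 : 2 * r / 2 = r := by omega
      rw [h1, h2, h3, Finset.sum_range_succ]
      ring
    · have h1 : (2 * r + 1) / 2 = r := by omega
      have h2 : (2 * r + 1 + 1) / 2 = r + 1 := by omega
      have h3 : (2 * r + 1 + 1 + 1) / 2 = r + 1 := by omega
      rw [h1, h2, h3, Finset.sum_range_succ _ r, Finset.sum_range_succ _ r]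
      ring

end Pathwise

end RegenChain

/-! ### Exponential moments, lower tails and a maximal inequality. -/

namespace RegenChain

/-- Two regimes. If `|z| ≤ 2βH` then `|lz| ≤ 1` and Taylor's bound applies. Otherwise `|lz| ≤ |z| /
(2β)`, and `|z| / β ≥ 2H` turns this into at most `|z| / β - H`. -/
theorem exp_mul_le_of_scale {z l β H : ℝ} (hβ : 0 < β) (hH : 1 ≤ H) (hl : |l| * (2 * β * H) ≤ 1) :
    Real.exp (l * z) ≤
      1 + l * z + l ^ 2 * z ^ 2 + Real.exp (-H) * Real.exp (|z| / β) := by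
  have hβH : 0 < 2 * β * H := by positivity
  rcases le_or_gt |z| (2 * β * H) with hz | hz
  · have h1 : |l * z| ≤ 1 := by
      rw [abs_mul]
      exact (mul_le_mul_of_nonneg_left hz (abs_nonneg l)).trans hl
    have h2 := (abs_le.1 (Real.abs_exp_sub_one_sub_id_le h1)).2
    have h3 : 0 ≤ Real.exp (-H) * Real.exp (|z| / β) := by positivity
    nlinarith
  · have h1 : Real.exp (l * z) ≤ 1 + l * z + Real.exp |l * z| := by
      rcases le_total 0 (l * z) with h | h
      · rw [abs_of_nonneg h]
        linarith
      · rw [abs_of_nonpos h]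
        have := Real.add_one_le_exp (-(l * z))
        have : Real.exp (l * z) ≤ 1 := Real.exp_le_one_iff.2 h
        linarith
    have h2 : Real.exp |l * z| ≤ Real.exp (-H) * Real.exp (|z| / β) := by
      rw [← Real.exp_add]
      refine Real.exp_le_exp.2 ?_
      rw [abs_mul]
      have hl2 : |l| ≤ 1 / (2 * β) := by
        rw [le_div_iff₀ (by positivity)]
        refine le_trans ?_ hl
        have : 0 ≤ |l| * (2 * β) := by positivity
        nlinarith
      have h3 : |l| * |z| ≤ |z| / β / 2 := by
        calc |l| * |z| ≤ 1 / (2 * β) * |z| := by gcongr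
          _ = |z| / β / 2 := by field_simp
      have h4 : 2 * H ≤ |z| / β := by
        rw [le_div_iff₀ hβ]
        linarith
      linarith
    have h3 : 0 ≤ l ^ 2 * z ^ 2 := by positivity
    linarith

section Mgf

variable {Ω : Type*} [MeasurableSpace Ω] {μ : Measure Ω} {Z : Ω → ℝ}

theorem integrable_of_exp {β : ℝ} (hβ : 0 < β) (hZ : AEMeasurable Z μ)
    (hi : Integrable (fun ω => Real.exp (|Z ω| / β)) μ) : Integrable Z μ := by
  refine (hi.const_mul β).mono' hZ.aestronglyMeasurable (Filter.Eventually.of_forall fun ω => ?_)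
  have h := Real.add_one_le_exp (|Z ω| / β)
  have h2 : |Z ω| = β * (|Z ω| / β) := by field_simp
  rw [Real.norm_eq_abs, h2]
  have : |Z ω| / β ≤ Real.exp (|Z ω| / β) := by linarith
  simpa only [← h2] using mul_le_mul_of_nonneg_left this hβ.le

theorem integrable_sq_of_exp {β : ℝ} (hβ : 0 < β) (hZ : AEMeasurable Z μ)
    (hi : Integrable (fun ω => Real.exp (|Z ω| / β)) μ) : Integrable (fun ω => Z ω ^ 2) μ := by
  refine (hi.const_mul (2 * β ^ 2)).mono' (hZ.pow_const 2).aestronglyMeasurable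
    (Filter.Eventually.of_forall fun ω => ?_)
  have h := Real.quadratic_le_exp_of_nonneg (div_nonneg (abs_nonneg (Z ω)) hβ.le)
  have h2 : Z ω ^ 2 = β ^ 2 * (|Z ω| / β) ^ 2 := by
    rw [div_pow, sq_abs]; field_simp
  have h3 : 0 ≤ |Z ω| / β := by positivity
  have h4 : (|Z ω| / β) ^ 2 ≤ 2 * Real.exp (|Z ω| / β) := by linarith
  rw [Real.norm_eq_abs, abs_of_nonneg (sq_nonneg _), h2]
  calc β ^ 2 * (|Z ω| / β) ^ 2 ≤ β ^ 2 * (2 * Real.exp (|Z ω| / β)) := by gcongr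
    _ = _ := by ring

variable [IsProbabilityMeasure μ]

/-- Bernstein-type bound for the exponential moments of a centred variable with finite
exponential moments: the scale loses only the factor `H`, at the price of an error `exp (-H)`. -/
theorem integral_exp_mul_le {β H l : ℝ} (hβ : 0 < β) (hH : 1 ≤ H) (hl : |l| * (2 * β * H) ≤ 1)
    (hZ : AEMeasurable Z μ) (hi : Integrable (fun ω => Real.exp (|Z ω| / β)) μ)
    (hle : ∫ ω, Real.exp (|Z ω| / β) ∂μ ≤ 2) (h0 : ∫ ω, Z ω ∂μ = 0) :
    Integrable (fun ω => Real.exp (l * Z ω)) μ ∧ 1 ≤ ∫ ω, Real.exp (l * Z ω) ∂μ ∧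
      ∫ ω, Real.exp (l * Z ω) ∂μ ≤
        Real.exp (l ^ 2 * Var[Z; μ] + 2 * Real.exp (-H)) := by
  have hZ1 := integrable_of_exp hβ hZ hi
  have hZ2 := integrable_sq_of_exp hβ hZ hi
  have hlin : Integrable (fun ω => 1 + l * Z ω) μ :=
    (integrable_const _).add (hZ1.const_mul l)
  have hquad : Integrable (fun ω => 1 + l * Z ω + l ^ 2 * Z ω ^ 2) μ :=
    hlin.add (hZ2.const_mul _)
  have hdom : Integrable (fun ω => 1 + l * Z ω + l ^ 2 * Z ω ^ 2 +
      Real.exp (-H) * Real.exp (|Z ω| / β)) μ := hquad.add (hi.const_mul _)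
  have hint : Integrable (fun ω => Real.exp (l * Z ω)) μ := by
    refine hdom.mono' (hZ.const_mul l).exp.aestronglyMeasurable
      (Filter.Eventually.of_forall fun ω => ?_)
    rw [Real.norm_eq_abs, Real.abs_exp]
    exact exp_mul_le_of_scale hβ hH hl
  refine ⟨hint, ?_, ?_⟩
  -- Centring gives this lower bound, which later makes the exponential process a submartingale.
  · have : ∫ ω, (1 + l * Z ω) ∂μ ≤ ∫ ω, Real.exp (l * Z ω) ∂μ := by
      refine integral_mono ((integrable_const _).add (hZ1.const_mul l)) hint fun ω => ?_
      have := Real.add_one_le_exp (l * Z ω)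
      simp only
      linarith
    rw [integral_add (integrable_const _) (hZ1.const_mul l), integral_const_mul, h0] at this
    simpa using this
  · have h1 : ∫ ω, Real.exp (l * Z ω) ∂μ ≤ ∫ ω, (1 + l * Z ω + l ^ 2 * Z ω ^ 2 +
        Real.exp (-H) * Real.exp (|Z ω| / β)) ∂μ :=
      integral_mono hint hdom fun ω => exp_mul_le_of_scale hβ hH hl
    rw [integral_add hquad (hi.const_mul _), integral_add hlin (hZ2.const_mul _), integral_add (integrable_const _) (hZ1.const_mul l),
      integral_const_mul, integral_const_mul, integral_const_mul, h0] at h1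
    have hvar : Var[Z; μ] = ∫ ω, Z ω ^ 2 ∂μ := by
      rw [variance_of_integral_eq_zero hZ h0]
    have h2 := Real.add_one_le_exp (l ^ 2 * Var[Z; μ] + 2 * Real.exp (-H))
    have h3 := mul_le_mul_of_nonneg_left hle (Real.exp_pos (-H)).le
    rw [hvar] at h2 ⊢
    simp only [integral_const, probReal_univ, smul_eq_mul] at h1
    linarith

/-- Lower tail of a sum of independent nonnegative square integrable variables. -/
theorem measure_sum_le_half_mean {U : ℕ → Ω → ℝ} (hind : iIndepFun U μ)
    (hU : ∀ i, Measurable (U i)) (h0 : ∀ i ω, 0 ≤ U i ω) {e v : ℝ} (he : 0 ≤ e) (hv : 0 < v)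
    (hi : ∀ i, Integrable (U i) μ) (hi2 : ∀ i, Integrable (fun ω => U i ω ^ 2) μ)
    (hmean : ∀ i, ∫ ω, U i ω ∂μ = e) (hsq : ∀ i, ∫ ω, U i ω ^ 2 ∂μ ≤ v) (L : ℕ) :
    μ.real {ω | ∑ i ∈ Finset.range L, U i ω ≤ L * e / 2} ≤
      Real.exp (-(L * e ^ 2 / (8 * v))) := by
  have hint : ∀ s : ℝ, s ≤ 0 → ∀ i, Integrable (fun ω => Real.exp (s * U i ω)) μ := by
    intro s hs i
    refine (integrable_const (1 : ℝ)).mono' ((hU i).const_mul s).exp.aestronglyMeasurable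
      (Filter.Eventually.of_forall fun ω => ?_)
    rw [Real.norm_eq_abs, Real.abs_exp]
    exact Real.exp_le_one_iff.2 (mul_nonpos_of_nonpos_of_nonneg hs (h0 i ω))
  have hmgf : ∀ s : ℝ, s ≤ 0 → ∀ i, mgf (U i) μ s ≤ Real.exp (s * e + s ^ 2 * v / 2) := by
    intro s hs i
    have hpt : ∀ ω, Real.exp (s * U i ω) ≤ 1 + s * U i ω + s ^ 2 / 2 * U i ω ^ 2 := by
      intro ω
      have h1 := Real.quadratic_le_exp_of_nonneg
        (neg_nonneg.2 (mul_nonpos_of_nonpos_of_nonneg hs (h0 i ω)))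
      set x := s * U i ω with hx
      have hx0 : x ≤ 0 := mul_nonpos_of_nonpos_of_nonneg hs (h0 i ω)
      have h2 : Real.exp x * Real.exp (-x) = 1 := by rw [← Real.exp_add]; simp
      have h3 : Real.exp x * (1 + -x + (-x) ^ 2 / 2) ≤ 1 := by
        exact (mul_le_mul_of_nonneg_left h1 (Real.exp_pos x).le).trans h2.le
      have e1 : s ^ 2 / 2 * U i ω ^ 2 = x ^ 2 / 2 := by rw [hx]; ring
      rw [e1]
      -- With `q(x) = 1 + x + x² / 2` one has `q(x) q(-x) = 1 + x⁴ / 4 ≥ 1`, so `q(-x) ≤ exp (-x)`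
      -- forces `exp x ≤ q(x)` for `x ≤ 0`.
      by_contra hcon
      push Not at hcon
      nlinarith [sq_nonneg (x ^ 2), sq_nonneg x]
    have hlin : Integrable (fun ω => 1 + s * U i ω) μ :=
      (integrable_const _).add ((hi i).const_mul s)
    have h1 : mgf (U i) μ s ≤ ∫ ω, (1 + s * U i ω + s ^ 2 / 2 * U i ω ^ 2) ∂μ :=
      integral_mono (hint s hs i) (hlin.add ((hi2 i).const_mul _)) hpt
    rw [integral_add hlin ((hi2 i).const_mul _),
      integral_add (integrable_const _) ((hi i).const_mul s), integral_const_mul,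
      integral_const_mul, hmean i] at h1
    have h2 := Real.add_one_le_exp (s * e + s ^ 2 * v / 2)
    have h3 : s ^ 2 / 2 * ∫ ω, U i ω ^ 2 ∂μ ≤ s ^ 2 / 2 * v := by
      gcongr
      exact hsq i
    simp only [integral_const, probReal_univ, smul_eq_mul] at h1
    linarith
  -- The Chernoff exponent is `L (s e / 2 + s² v / 2)`, minimized at `s = -e / (2v)`.
  have hs : -(e / (2 * v)) ≤ 0 := by
    rw [neg_nonpos]; positivity
  have hsumint : Integrable (fun ω => Real.exp (-(e / (2 * v)) *
      (∑ i ∈ Finset.range L, U i) ω)) μ :=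
    hind.integrable_exp_mul_sum hU fun i _ => hint _ hs i
  have hch := measure_le_le_exp_mul_mgf (μ := μ) (X := ∑ i ∈ Finset.range L, U i)
    (L * e / 2) hs hsumint
  simp only [Finset.sum_apply] at hch
  refine hch.trans ?_
  rw [hind.mgf_sum hU]
  have hprod : ∏ i ∈ Finset.range L, mgf (U i) μ (-(e / (2 * v))) ≤
      Real.exp (-(e / (2 * v)) * e + (-(e / (2 * v))) ^ 2 * v / 2) ^ L := by
    refine (Finset.prod_le_prod (fun i _ => mgf_nonneg) fun i _ => hmgf _ hs i).trans ?_
    simp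
  refine (mul_le_mul_of_nonneg_left hprod (Real.exp_pos _).le).trans ?_
  rw [← Real.exp_nat_mul, ← Real.exp_add]
  refine Real.exp_le_exp.2 (le_of_eq ?_)
  field_simp
  ring

/-- Exponential maximal inequality for the partial sums of independent variables whose
exponential moments are at least one. -/
theorem measure_exists_sum_gt_le {ξ : ℕ → Ω → ℝ} (ℱ : Filtration ℕ ‹MeasurableSpace Ω›)
    (hξ : ∀ k, Measurable[ℱ (k + 1)] (ξ k))
    (hind : ∀ k, Indep (MeasurableSpace.comap (ξ k) inferInstance) (ℱ k) μ)
    {l φ : ℝ} (hl : 0 ≤ l) (hint : ∀ k, Integrable (fun ω => Real.exp (l * ξ k ω)) μ)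
    (hone : ∀ k, 1 ≤ ∫ ω, Real.exp (l * ξ k ω) ∂μ)
    (hle : ∀ k, ∫ ω, Real.exp (l * ξ k ω) ∂μ ≤ φ) (L : ℕ) (s : ℝ) :
    μ {ω | ∃ k ≤ L, s < ∑ j ∈ Finset.range k, ξ j ω} ≤
      ENNReal.ofReal (Real.exp (-(l * s)) * φ ^ L) := by
  set W : ℕ → Ω → ℝ := fun k ω => ∑ j ∈ Finset.range k, ξ j ω with hW
  have hξm : ∀ k, Measurable (ξ k) := fun k => (hξ k).mono (ℱ.le _) le_rfl
  have hWm : ∀ k, Measurable[ℱ k] (W k) := by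
    intro k
    refine Finset.measurable_sum _ fun j hj => (hξ j).mono (ℱ.mono ?_) le_rfl
    have := Finset.mem_range.1 hj
    omega
  set M : ℕ → Ω → ℝ := fun k ω => Real.exp (l * W k ω) with hM
  have hMm : ∀ k, Measurable[ℱ k] (M k) := fun k => ((hWm k).const_mul l).exp
  have hMsucc : ∀ k, M (k + 1) = M k * fun ω => Real.exp (l * ξ k ω) := by
    intro k
    funext ω
    simp only [hM, hW, Pi.mul_apply, ← Real.exp_add, Finset.sum_range_succ]
    ring_nf
  have hindf : ∀ k, IndepFun (M k) (fun ω => Real.exp (l * ξ k ω)) μ := by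
    intro k
    have h1 : IndepFun (ξ k) (M k) μ :=
      indep_of_indep_of_le_right (hind k) (hMm k).comap_le
    exact (h1.comp (φ := fun x => Real.exp (l * x)) (ψ := id)
      (measurable_id.const_mul l).exp measurable_id).symm
  have hMint : ∀ k, Integrable (M k) μ ∧ ∫ ω, M k ω ∂μ ≤ φ ^ k := by
    intro k
    induction k with
    | zero => simp [hM, hW]
    | succ k ih =>
      rw [hMsucc]
      refine ⟨(hindf k).integrable_mul ih.1 (hint k), ?_⟩
      have := (hindf k).integral_mul_eq_mul_integral ih.1.aestronglyMeasurable
        (hint k).aestronglyMeasurable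
      rw [this, pow_succ]
      exact mul_le_mul ih.2 (hle k) (by linarith [hone k])
        (pow_nonneg (by linarith [hone k, hle k]) _)
  -- Each step multiplies by a factor independent of the past whose mean is at least one.
  have hsub : Submartingale M ℱ μ := by
    refine submartingale_nat (fun k => (hMm k).stronglyMeasurable) (fun k => (hMint k).1)
      fun k => ?_
    have h1 : μ[M (k + 1) | ℱ k] =ᵐ[μ] M k * μ[fun ω => Real.exp (l * ξ k ω) | ℱ k] := by
      rw [hMsucc]
      refine condExp_mul_of_stronglyMeasurable_left (hMm k).stronglyMeasurable ?_ (hint k)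
      rw [← hMsucc]
      exact (hMint (k + 1)).1
    have h2 : μ[fun ω => Real.exp (l * ξ k ω) | ℱ k] =ᵐ[μ]
        fun _ => ∫ ω, Real.exp (l * ξ k ω) ∂μ := by
      refine condExp_indep_eq (m₁ := MeasurableSpace.comap (ξ k) inferInstance)
        (hξm k).comap_le (ℱ.le k) ?_ (hind k)
      exact (((comap_measurable (ξ k)).const_mul l).exp).stronglyMeasurable
    filter_upwards [h1, h2] with ω h1 h2
    rw [h1, Pi.mul_apply, h2]
    exact le_mul_of_one_le_right (Real.exp_pos _).le (hone k)
  obtain ⟨ε, hε⟩ : ∃ ε : NNReal, (ε : ℝ) = Real.exp (l * s) := ⟨⟨_, (Real.exp_pos _).le⟩, rfl⟩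
  have hmax := maximal_ineq hsub (fun k ω => (Real.exp_pos _).le) (ε := ε) L
  set A : Set Ω := {ω | (ε : ℝ) ≤
    (Finset.range (L + 1)).sup' Finset.nonempty_range_add_one fun k => M k ω} with hA
  have hsubset : {ω | ∃ k ≤ L, s < ∑ j ∈ Finset.range k, ξ j ω} ⊆ A := by
    rintro ω ⟨k, hk, hks⟩
    refine Finset.le_sup'_of_le (fun k => M k ω) (Finset.mem_range.2 (Nat.lt_succ_of_le hk)) ?_
    rw [hε]
    exact Real.exp_le_exp.2 (mul_le_mul_of_nonneg_left hks.le hl)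
  refine (measure_mono hsubset).trans ?_
  have hAint : ENNReal.ofReal (∫ ω in A, M L ω ∂μ) ≤ ENNReal.ofReal (φ ^ L) :=
    ENNReal.ofReal_le_ofReal ((setIntegral_le_integral (hMint L).1
      (Filter.Eventually.of_forall fun ω => (Real.exp_pos _).le)).trans (hMint L).2)
  have hcoe : (ε : ℝ≥0∞) = ENNReal.ofReal (Real.exp (l * s)) := by
    rw [← hε, ENNReal.ofReal_coe_nnreal]
  rw [hcoe] at hmax
  have hfin := hmax.trans hAint
  calc μ A = ENNReal.ofReal (Real.exp (-(l * s))) * (ENNReal.ofReal (Real.exp (l * s)) * μ A) := by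
        rw [← mul_assoc, ← ENNReal.ofReal_mul (Real.exp_pos _).le, ← Real.exp_add]
        simp
    _ ≤ ENNReal.ofReal (Real.exp (-(l * s))) * ENNReal.ofReal (φ ^ L) := by gcongr
    _ = _ := by rw [← ENNReal.ofReal_mul (Real.exp_pos _).le]

end Mgf

end RegenChain

/-! ### Consequences of exponential moments, and sums of every other block. -/

namespace RegenChain

section Moments

variable {Ω : Type*} [MeasurableSpace Ω] {μ : Measure Ω} [IsProbabilityMeasure μ] {T : Ω → ℝ}
  {c : ℝ}

theorem measure_lt_le_of_exp (hc : 0 < c) (hT : ∀ ω, 0 ≤ T ω)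
    (hi : Integrable (fun ω => Real.exp (|T ω| / c)) μ)
    (hle : ∫ ω, Real.exp (|T ω| / c) ∂μ ≤ 2) (s : ℝ) :
    μ {ω | s < T ω} ≤ ENNReal.ofReal (2 * Real.exp (-(s / c))) := by
  have hTabs : ∀ ω, |T ω| / c = 1 / c * T ω := fun ω => by rw [abs_of_nonneg (hT ω)]; ring
  simp only [hTabs] at hi hle
  have h := measure_ge_le_exp_mul_mgf (μ := μ) (X := T) s (one_div_pos.2 hc).le hi
  calc μ {ω | s < T ω} ≤ μ {ω | s ≤ T ω} := measure_mono fun ω (hω : s < T ω) => hω.le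
    _ = ENNReal.ofReal (μ.real {ω | s ≤ T ω}) := (ofReal_measureReal).symm
    _ ≤ _ := by
      refine ENNReal.ofReal_le_ofReal (h.trans ?_)
      have h2 : mgf T μ (1 / c) ≤ 2 := hle
      have h3 := mul_le_mul_of_nonneg_left h2 (Real.exp_pos (-(1 / c) * s)).le
      have h4 : -(1 / c) * s = -(s / c) := by ring
      rw [h4] at h3 ⊢
      linarith

theorem integral_le_of_exp (hc : 0 < c) (hT : ∀ ω, 0 ≤ T ω) (hm : AEMeasurable T μ)
    (hi : Integrable (fun ω => Real.exp (|T ω| / c)) μ)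
    (hle : ∫ ω, Real.exp (|T ω| / c) ∂μ ≤ 2) : ∫ ω, T ω ∂μ ≤ c := by
  have h1 : ∫ ω, T ω ∂μ ≤ ∫ ω, c * (Real.exp (|T ω| / c) - 1) ∂μ := by
    refine integral_mono (integrable_of_exp hc hm hi) ((hi.sub (integrable_const 1)).const_mul c)
      fun ω => ?_
    have := Real.add_one_le_exp (|T ω| / c)
    calc T ω = c * (|T ω| / c) := by rw [abs_of_nonneg (hT ω)]; field_simp
      _ ≤ c * (Real.exp (|T ω| / c) - 1) := by gcongr; linarith
  rw [integral_const_mul, integral_sub hi (integrable_const 1)] at h1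
  simp only [integral_const, probReal_univ, smul_eq_mul] at h1
  nlinarith

theorem integral_sq_le_of_exp (hc : 0 < c) (hT : ∀ ω, 0 ≤ T ω) (hm : AEMeasurable T μ)
    (hi : Integrable (fun ω => Real.exp (|T ω| / c)) μ)
    (hle : ∫ ω, Real.exp (|T ω| / c) ∂μ ≤ 2) : ∫ ω, T ω ^ 2 ∂μ ≤ 2 * c ^ 2 := by
  have h1 : ∫ ω, T ω ^ 2 ∂μ ≤ ∫ ω, 2 * c ^ 2 * (Real.exp (|T ω| / c) - 1) ∂μ := by
    refine integral_mono (integrable_sq_of_exp hc hm hi)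
      ((hi.sub (integrable_const 1)).const_mul _) fun ω => ?_
    have h0 : 0 ≤ |T ω| / c := by positivity
    have := Real.quadratic_le_exp_of_nonneg h0
    calc T ω ^ 2 = 2 * c ^ 2 * ((|T ω| / c) ^ 2 / 2) := by
          rw [abs_of_nonneg (hT ω)]; field_simp
      _ ≤ 2 * c ^ 2 * (Real.exp (|T ω| / c) - 1) := by gcongr; linarith
  rw [integral_const_mul, integral_sub hi (integrable_const 1)] at h1
  simp only [integral_const, probReal_univ, smul_eq_mul] at h1
  nlinarith [sq_nonneg c]

end Moments

section Chain

variable {Ω S : Type*} [MeasurableSpace Ω] [MeasurableSpace S] {μ : Measure Ω}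
  {P : Kernel S S} {m : ℕ} {X : ℕ → Ω → S} {R : ℕ → Ω → Fin 2}

theorem IsRegenerative.measurable_blockSum (h : IsRegenerative μ P m X R) {f : S → ℝ}
    (hf : Measurable f) (i : ℕ) : Measurable (blockSum m R X f (i + 1)) := by
  rw [blockSum_eq_wordSum]
  exact (measurable_wordSum hf).comp (measurable_block h.isMarkovChain.measurable h.measurable_R _)

theorem IsRegenerative.identDistrib_blockSum (h : IsRegenerative μ P m X R) {f : S → ℝ}
    (hf : Measurable f) (i : ℕ) :
    IdentDistrib (blockSum m R X f (i + 1)) (blockSum m R X f 1) μ μ := by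
  induction i with
  | zero => exact IdentDistrib.refl (h.measurable_blockSum hf 0).aemeasurable
  | succ i ih =>
    refine IdentDistrib.trans ?_ ih
    have := h.stationary_blocks.comp
      ((measurable_wordSum hf).comp (measurable_pi_apply (X := fun _ => Σ k : ℕ, (Fin k → S)) i))
    rw [blockSum_eq_wordSum, blockSum_eq_wordSum]
    exact this.symm

/-- The σ-algebras generated by the first `2 k + q` blocks. -/
noncomputable def blockFiltration (h : IsRegenerative μ P m X R) (q : ℕ) :
    Filtration ℕ ‹MeasurableSpace Ω› where
  seq k := ⨆ j : {j : ℕ // j < 2 * k + q}, MeasurableSpace.comap (block m R X j) inferInstance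
  mono' k l hkl := iSup_le fun j => le_iSup
    (fun j : {j : ℕ // j < 2 * l + q} => MeasurableSpace.comap (block m R X j) inferInstance)
    ⟨j.1, j.2.trans_le (by omega)⟩
  le' k := iSup_le fun j =>
    (measurable_block h.isMarkovChain.measurable h.measurable_R j).comap_le

theorem IsRegenerative.measurable_blockFiltration (h : IsRegenerative μ P m X R) {f : S → ℝ}
    (hf : Measurable f) (q k : ℕ) :
    Measurable[blockFiltration h q (k + 1)] (blockSum m R X f (2 * k + q + 1)) := by
  rw [blockSum_eq_wordSum]
  refine (measurable_wordSum hf).comp (measurable_iff_comap_le.2 ?_)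
  exact le_iSup (fun j : {j : ℕ // j < 2 * (k + 1) + q} =>
    MeasurableSpace.comap (block m R X j) inferInstance) ⟨2 * k + q + 1, by omega⟩

/-- The filtration at `k` stops before block `2k + q`. That omitted block is the gap that
one-dependence requires. -/
theorem IsRegenerative.indep_blockFiltration (h : IsRegenerative μ P m X R) {f : S → ℝ}
    (hf : Measurable f) (q k : ℕ) :
    Indep (MeasurableSpace.comap (blockSum m R X f (2 * k + q + 1)) inferInstance)
      (blockFiltration h q k) μ := by
  refine (indep_of_indep_of_le_right (h.oneDependent (2 * k + q)) ?_).symm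
  rw [blockSum_eq_wordSum, ← MeasurableSpace.comap_comp]
  refine (MeasurableSpace.comap_mono (measurable_wordSum hf).comap_le).trans ?_
  exact le_iSup (fun j : {j : ℕ // 2 * k + q < j} =>
    MeasurableSpace.comap (block m R X j) inferInstance) ⟨2 * k + q + 1, by omega⟩

/-- Only `T₂, T₃, …` share a law, so `T₁` needs its own hypothesis. -/
theorem IsRegenerative.exp_regenTime (h : IsRegenerative μ P m X R) {c : ℝ}
    (h1 : Integrable (fun ω => Real.exp (|(regenTime m R 1 ω : ℝ)| / c)) μ ∧
      ∫ ω, Real.exp (|(regenTime m R 1 ω : ℝ)| / c) ∂μ ≤ 2)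
    (h2 : Integrable (fun ω => Real.exp (|(regenTime m R 2 ω : ℝ)| / c)) μ ∧
      ∫ ω, Real.exp (|(regenTime m R 2 ω : ℝ)| / c) ∂μ ≤ 2) (i : ℕ) :
    Integrable (fun ω => Real.exp (|(regenTime m R (i + 1) ω : ℝ)| / c)) μ ∧
      ∫ ω, Real.exp (|(regenTime m R (i + 1) ω : ℝ)| / c) ∂μ ≤ 2 := by
  rcases i with _ | i
  · exact h1
  · have hid : IdentDistrib (fun ω => Real.exp (|(regenTime m R (i + 2) ω : ℝ)| / c))
        (fun ω => Real.exp (|(regenTime m R 2 ω : ℝ)| / c)) μ μ :=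
      (h.identDistrib_times (i + 2) (by omega)).comp
        (measurable_of_countable fun k : ℕ => Real.exp (|(k : ℝ)| / c))
    exact ⟨hid.integrable_iff.2 h2.1, hid.integral_eq.trans_le h2.2⟩

variable [IsProbabilityMeasure μ]

/-- Maximal tail bound for the sums of every other block. -/
theorem IsRegenerative.measure_exists_sum_blockSum_gt (h : IsRegenerative μ P m X R) (hm : 0 < m)
    {f : S → ℝ} (hf : Measurable f) {a : ℝ} (ha : 0 < a) (hfa : ∀ x, |f x| ≤ a)
    {c : ℝ} (hc : 0 < c)
    (h2 : Integrable (fun ω => Real.exp (|(regenTime m R 2 ω : ℝ)| / c)) μ ∧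
      ∫ ω, Real.exp (|(regenTime m R 2 ω : ℝ)| / c) ∂μ ≤ 2)
    (h0 : ∫ ω, blockSum m R X f 1 ω ∂μ = 0)
    {H l : ℝ} (hH : 1 ≤ H) (hl : 0 ≤ l) (hlH : l * (2 * (a * m * c) * H) ≤ 1)
    {ε : ℝ} (hε : |ε| = 1) (q L : ℕ) (s : ℝ) :
    μ {ω | ∃ k ≤ L, s < ∑ j ∈ Finset.range k, ε * blockSum m R X f (2 * j + q + 1) ω} ≤
      ENNReal.ofReal (Real.exp (-(l * s) +
        L * (l ^ 2 * Var[blockSum m R X f 1; μ] + 2 * Real.exp (-H)))) := by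
  have hmR : (0 : ℝ) < m := by exact_mod_cast hm
  have hβ : 0 < a * m * c := by positivity
  -- Since `|Z₁| ≤ a m T₂`, the block sum inherits the exponential moment of `T₂` at scale `a m c`.
  have hpt : ∀ ω, |blockSum m R X f 1 ω| / (a * m * c) ≤ |(regenTime m R 2 ω : ℝ)| / c := by
    intro ω
    rw [div_le_div_iff₀ hβ hc, abs_of_nonneg (Nat.cast_nonneg (α := ℝ) _)]
    have := mul_le_mul_of_nonneg_right (abs_blockSum_le (m := m) (R := R) (ω := ω) hm (X := X)
      hfa 1) hc.le
    calc _ ≤ _ := this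
      _ = _ := by ring
  have hZm : ∀ i, Measurable (blockSum m R X f (i + 1)) := h.measurable_blockSum hf
  have hmexp : Measurable fun z : ℝ => Real.exp (|z| / (a * m * c)) := by fun_prop
  have hZi : Integrable (fun ω => Real.exp (|blockSum m R X f 1 ω| / (a * m * c))) μ := by
    refine h2.1.mono' (hmexp.comp (hZm 0)).aestronglyMeasurable
      (Filter.Eventually.of_forall fun ω => ?_)
    rw [Real.norm_eq_abs, Real.abs_exp]
    exact Real.exp_le_exp.2 (hpt ω)
  have hZle : ∫ ω, Real.exp (|blockSum m R X f 1 ω| / (a * m * c)) ∂μ ≤ 2 :=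
    (integral_mono hZi h2.1 fun ω => Real.exp_le_exp.2 (hpt ω)).trans h2.2
  have hle' : |l * ε| * (2 * (a * m * c) * H) ≤ 1 := by
    rw [abs_mul, hε, mul_one, abs_of_nonneg hl]
    exact hlH
  have key : ∀ i, Integrable (fun ω => Real.exp (l * (ε * blockSum m R X f (i + 1) ω))) μ ∧
      1 ≤ ∫ ω, Real.exp (l * (ε * blockSum m R X f (i + 1) ω)) ∂μ ∧
      ∫ ω, Real.exp (l * (ε * blockSum m R X f (i + 1) ω)) ∂μ ≤
        Real.exp (l ^ 2 * Var[blockSum m R X f 1; μ] + 2 * Real.exp (-H)) := by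
    intro i
    have hid := h.identDistrib_blockSum hf i
    have hide : IdentDistrib (fun ω => Real.exp (l * (ε * blockSum m R X f (i + 1) ω)))
        (fun ω => Real.exp (l * (ε * blockSum m R X f 1 ω))) μ μ :=
      hid.comp (u := fun z : ℝ => Real.exp (l * (ε * z))) (by fun_prop)
    have := integral_exp_mul_le (μ := μ) hβ hH hle' (hZm 0).aemeasurable hZi hZle h0
    have hsq : (l * ε) ^ 2 = l ^ 2 := by rw [mul_pow, ← sq_abs ε, hε]; ring
    simp only [mul_assoc, hsq] at this
    exact ⟨hide.integrable_iff.2 this.1, hide.integral_eq ▸ this.2.1,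
      hide.integral_eq ▸ this.2.2⟩
  refine (measure_exists_sum_gt_le (μ := μ) (blockFiltration h q)
    (ξ := fun k ω => ε * blockSum m R X f (2 * k + q + 1) ω) (fun k => ?_) (fun k => ?_) hl
    (fun k => (key _).1) (fun k => (key _).2.1) (fun k => (key _).2.2) L s).trans (le_of_eq ?_)
  · exact (h.measurable_blockFiltration hf q k).const_mul ε
  · refine (indep_of_indep_of_le_right (h.indep_blockFiltration hf q k).symm ?_).symm
    exact (measurable_iff_comap_le.1 ((comap_measurable (blockSum m R X f (2 * k + q + 1))).const_mul ε))
  · rw [← Real.exp_nat_mul, ← Real.exp_add]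

end Chain

end RegenChain

/-! ### Tail bound for centred block sums. -/

namespace RegenChain

section Chain

variable {Ω S : Type*} [MeasurableSpace Ω] [MeasurableSpace S] {μ : Measure Ω}
  {P : Kernel S S} {m : ℕ} {X : ℕ → Ω → S} {R : ℕ → Ω → Fin 2}

/-- The exceptional events that control a large deviation of the partial sums. -/
theorem IsRegenerative.measure_abs_sum_gt_le_add (h : IsRegenerative μ P m X R) (hm : 0 < m)
    {f : S → ℝ} {a : ℝ} (ha : 0 < a) (hfa : ∀ x, |f x| ≤ a) {n : ℕ} {t : ℝ} (L : ℕ) {e : ℝ}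
    (he : (n : ℝ) / m ≤ e) :
    μ {ω | t < |∑ i ∈ Finset.Icc 1 n, f (X i ω)|} ≤
      ∑ k ∈ Finset.range (L + 1), μ {ω | t / (8 * (a * m)) < (regenTime m R (k + 1) ω : ℝ)} +
      μ {ω | (regenSum m R (L + 1) ω : ℝ) ≤ e} +
      ∑ q ∈ Finset.range 2,
        (μ {ω | ∃ k ≤ L, t / 4 < ∑ j ∈ Finset.range k, 1 * blockSum m R X f (2 * j + q + 1) ω} +
        μ {ω | ∃ k ≤ L, t / 4 <
          ∑ j ∈ Finset.range k, (-1) * blockSum m R X f (2 * j + q + 1) ω}) := by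
  set A : ℕ → Set Ω := fun k => {ω | t / (8 * (a * m)) < (regenTime m R (k + 1) ω : ℝ)} with hA
  set B : Set Ω := {ω | (regenSum m R (L + 1) ω : ℝ) ≤ e} with hB
  set D : ℝ → ℕ → Set Ω := fun ε q => {ω | ∃ k ≤ L, t / 4 <
    ∑ j ∈ Finset.range k, ε * blockSum m R X f (2 * j + q + 1) ω} with hD
  have hmR : (0 : ℝ) < m := by exact_mod_cast hm
  set G : Set Ω := (⋃ k ∈ Finset.range (L + 1), A k) ∪ B ∪
    ⋃ q ∈ Finset.range 2, (D 1 q ∪ D (-1) q) with hG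
  have hcover : {ω | t < |∑ i ∈ Finset.Icc 1 n, f (X i ω)|} ≤ᵐ[μ] G := by
    filter_upwards [h.wellDefined] with ω hω (ht : t < _)
    change ω ∈ G
    by_contra hcon
    rw [hG] at hcon
    simp only [Set.mem_union, Set.mem_iUnion, not_or, not_exists, Finset.mem_range] at hcon
    obtain ⟨⟨h1, h2⟩, h3⟩ := hcon
    -- Off the counting event, `n < m S_{L+1}`, so time `n` falls in a block of index at most `L`.
    have hn : n < m * (regenSum m R (L + 1) ω + 1) := by
      have h4 : e < regenSum m R (L + 1) ω := not_le.1 h2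
      have h5 := he.trans_lt h4
      rw [div_lt_iff₀ hmR] at h5
      have h6 : n < regenSum m R (L + 1) ω * m := by exact_mod_cast h5
      have e1 : m * (regenSum m R (L + 1) ω + 1) = regenSum m R (L + 1) ω * m + m := by ring
      omega
    obtain ⟨k, hk, hle⟩ := exists_abs_sum_le hm hfa n L hn
    have hT : ∀ i ≤ L, a * m * (regenTime m R (i + 1) ω : ℝ) ≤ t / 8 := by
      intro i hi
      have := not_lt.1 (show ¬t / (8 * (a * m)) < (regenTime m R (i + 1) ω : ℝ) from h1 i (by omega))
      rw [le_div_iff₀ (by positivity)] at this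
      linarith
    have hT1 : (1 : ℝ) ≤ regenTime m R 1 ω := by exact_mod_cast regenTime_pos hω 0
    have hT1' := hT 0 (by omega)
    have hTk := hT k hk
    have ham : 0 < a * m := by positivity
    have hsplit := sum_range_eq_odd_add_even (fun i => blockSum m R X f (i + 1) ω) (k - 1)
    have hW : ∀ q < 2, ∀ k' ≤ L,
        |∑ j ∈ Finset.range k', blockSum m R X f (2 * j + q + 1) ω| ≤ t / 4 := by
      intro q hq k' hk'
      obtain ⟨hp, hn⟩ := h3 q hq
      have hp' := not_lt.1 fun hlt => hp ⟨k', hk', hlt⟩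
      have hn' := not_lt.1 fun hlt => hn ⟨k', hk', hlt⟩
      rw [← Finset.mul_sum] at hp' hn'
      rw [abs_le]
      constructor <;> linarith
    have hW0 := hW 0 (by omega) ((k - 1 + 1) / 2) (by omega)
    have hW1 := hW 1 (by omega) ((k - 1) / 2) (by omega)
    have hW2 := abs_add_le
      (∑ j ∈ Finset.range ((k - 1 + 1) / 2), blockSum m R X f (2 * j + 0 + 1) ω)
      (∑ j ∈ Finset.range ((k - 1) / 2), blockSum m R X f (2 * j + 1 + 1) ω)
    simp only [add_zero] at hW0 hW2
    rw [← hsplit] at hW2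
    -- As `T₁ ≥ 1`, the extra `1` at most doubles the term. The budget is `t/4` for the first block,
    -- `t/8` for the current one and `t/4` per parity class: `7t/8` in all.
    have : a * m * ((regenTime m R 1 ω : ℝ) + 1) ≤ t / 4 := by nlinarith
    simp only [zero_add] at hT1'
    -- The sign of `t` is not assumed; it follows from this quantity being at most `t / 8`.
    have ht0 : 0 ≤ a * m * (regenTime m R (k + 1) ω : ℝ) := by positivity
    linarith
  refine (measure_mono_ae hcover).trans ((measure_union_le _ _).trans ?_)
  refine add_le_add ((measure_union_le _ _).trans ?_) ?_
  · exact add_le_add (measure_biUnion_finset_le _ _) le_rfl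
  · exact (measure_biUnion_finset_le _ _).trans (Finset.sum_le_sum fun q _ => measure_union_le _ _)

variable [IsProbabilityMeasure μ]

/-- The regeneration times have mean at least one. -/
theorem IsRegenerative.one_le_integral_regenTime (h : IsRegenerative μ P m X R)
    (hi : Integrable (fun ω => (regenTime m R 2 ω : ℝ)) μ) :
    1 ≤ ∫ ω, (regenTime m R 2 ω : ℝ) ∂μ := by
  have : ∫ _, (1 : ℝ) ∂μ ≤ ∫ ω, (regenTime m R 2 ω : ℝ) ∂μ := by
    refine integral_mono_ae (integrable_const _) hi ?_
    filter_upwards [h.wellDefined] with ω hω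
    exact_mod_cast regenTime_pos hω 1
  simpa using this

/-- It is unlikely that more than `L` blocks are completed by time `n`. -/
theorem IsRegenerative.measure_regenSum_le (h : IsRegenerative μ P m X R)
    {c : ℝ} (hc : 0 < c)
    (hT : ∀ i, Integrable (fun ω => Real.exp (|(regenTime m R (i + 1) ω : ℝ)| / c)) μ ∧
      ∫ ω, Real.exp (|(regenTime m R (i + 1) ω : ℝ)| / c) ∂μ ≤ 2) (L : ℕ) :
    μ {ω | (regenSum m R (L + 1) ω : ℝ) ≤ L * (∫ ω, (regenTime m R 2 ω : ℝ) ∂μ) / 2} ≤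
      ENNReal.ofReal (Real.exp (-(L * (∫ ω, (regenTime m R 2 ω : ℝ) ∂μ) ^ 2 / (16 * c ^ 2)))) := by
  set E := ∫ ω, (regenTime m R 2 ω : ℝ) ∂μ with hE
  -- `T₁` has a different law and is dropped, which only decreases the sum; hence `L + 1` times but
  -- `L` terms.
  set U : ℕ → Ω → ℝ := fun i ω => (regenTime m R (i + 2) ω : ℝ) with hU
  have hcast : Measurable fun k : ℕ => (k : ℝ) := measurable_of_countable _
  have hUm : ∀ i, Measurable (U i) := fun i => hcast.comp (measurable_regenTime h.measurable_R _)
  have hU0 : ∀ i ω, 0 ≤ U i ω := fun i ω => Nat.cast_nonneg _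
  have hind : iIndepFun U μ := by
    have h1 := h.indep_times.precomp (g := fun i : ℕ => i + 1) (fun i j hij => by simpa using hij)
    exact h1.comp (fun _ (k : ℕ) => (k : ℝ)) fun _ => hcast
  have hmean : ∀ i, ∫ ω, U i ω ∂μ = E := by
    intro i
    have : IdentDistrib (U i) (U 0) μ μ := (h.identDistrib_times (i + 2) (by omega)).comp hcast
    exact this.integral_eq
  have hE0 : 0 ≤ E := integral_nonneg fun ω => Nat.cast_nonneg _
  have key := measure_sum_le_half_mean (μ := μ) hind hUm hU0 hE0
    (by positivity : 0 < 2 * c ^ 2)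
    (fun i => integrable_of_exp hc (hUm i).aemeasurable (hT (i + 1)).1)
    (fun i => integrable_sq_of_exp hc (hUm i).aemeasurable (hT (i + 1)).1) hmean
    (fun i => integral_sq_le_of_exp hc (hU0 i) (hUm i).aemeasurable (hT (i + 1)).1
      (hT (i + 1)).2) L
  calc μ {ω | (regenSum m R (L + 1) ω : ℝ) ≤ L * E / 2}
      ≤ μ {ω | ∑ i ∈ Finset.range L, U i ω ≤ L * E / 2} := by
        refine measure_mono fun ω hω => le_trans ?_ (Set.mem_ofPred_eq ▸ hω)
        rw [regenSum_eq_sum, Finset.sum_range_succ']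
        push_cast
        exact le_add_of_nonneg_right (Nat.cast_nonneg _)
    _ = ENNReal.ofReal (μ.real {ω | ∑ i ∈ Finset.range L, U i ω ≤ L * E / 2}) :=
        (ofReal_measureReal).symm
    _ ≤ _ := by
        refine ENNReal.ofReal_le_ofReal (key.trans (le_of_eq ?_))
        congr 3
        ring

set_option maxHeartbeats 1000000 in
/-- Tail bound for the partial sums when the block sums are centred. -/
theorem IsRegenerative.measure_abs_sum_gt_le (h : IsRegenerative μ P m X R) (hm : 0 < m)
    {c : ℝ} (hc : 1 ≤ c)
    (hT : ∀ i, Integrable (fun ω => Real.exp (|(regenTime m R (i + 1) ω : ℝ)| / c)) μ ∧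
      ∫ ω, Real.exp (|(regenTime m R (i + 1) ω : ℝ)| / c) ∂μ ≤ 2)
    {f : S → ℝ} (hf : Measurable f) {a : ℝ} (ha : 0 < a) (hfa : ∀ x, |f x| ≤ a)
    (h0 : ∫ ω, blockSum m R X f 1 ω ∂μ = 0) {n : ℕ} (hn : 2 ≤ n) {t y : ℝ} (ht : 0 < t)
    (hy1 : y * (n * (m * ∫ ω, (regenTime m R 2 ω : ℝ) ∂μ)⁻¹ * Var[blockSum m R X f 1; μ]) ≤ t ^ 2)
    (hy2 : y * (c ^ 2 * a * m * Real.log n) ≤ t) :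
    μ {ω | t < |∑ i ∈ Finset.Icc 1 n, f (X i ω)|} ≤
      ENNReal.ofReal (2000 * Real.exp (-(y / 2000))) := by
  have hmR : (1 : ℝ) ≤ m := by exact_mod_cast hm
  have hnR : (2 : ℝ) ≤ n := by exact_mod_cast hn
  -- For small `y` the right side already exceeds one.
  rcases lt_or_ge y 16 with hy | hy
  · refine prob_le_one.trans ?_
    rw [← ENNReal.ofReal_one]
    refine ENNReal.ofReal_le_ofReal ?_
    have := Real.add_one_le_exp (-(y / 2000))
    nlinarith
  rcases lt_or_ge (n * a) t with htn | htn
  · have : {ω | t < |∑ i ∈ Finset.Icc 1 n, f (X i ω)|} = ∅ := by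
      ext ω
      simp only [Set.mem_ofPred_eq, Set.mem_empty_iff_false, iff_false, not_lt]
      refine (Finset.abs_sum_le_sum_abs _ _).trans
        ((Finset.sum_le_card_nsmul _ _ a fun j _ => hfa _).trans ?_)
      simpa using htn.le
    rw [this]
    simp
  set H := Real.log n with hHdef
  set E := ∫ ω, (regenTime m R 2 ω : ℝ) ∂μ with hE
  set σ2 := Var[blockSum m R X f 1; μ] with hσ
  have hc0 : 0 < c := by linarith
  have hcast : Measurable fun k : ℕ => (k : ℝ) := measurable_of_countable _
  have hTm : ∀ i, Measurable fun ω => (regenTime m R i ω : ℝ) :=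
    fun i => hcast.comp (measurable_regenTime h.measurable_R _)
  have hE1 : 1 ≤ E := h.one_le_integral_regenTime
    (integrable_of_exp hc0 (hTm 2).aemeasurable (hT 1).1)
  have hEc : E ≤ c := integral_le_of_exp hc0 (fun ω => Nat.cast_nonneg _) (hTm 2).aemeasurable
    (hT 1).1 (hT 1).2
  have hH2 : 1 / 2 ≤ H := by
    have h1 : Real.log 2 ≤ H := Real.log_le_log (by norm_num) hnR
    have h2 := Real.log_two_gt_d9
    linarith
  -- the size of `n`
  have hnbig : y * (c ^ 2 * m * H) ≤ n := by
    have h1 : y * (c ^ 2 * a * m * H) = y * (c ^ 2 * m * H) * a := by ring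
    rw [h1] at hy2
    exact le_of_mul_le_mul_right (hy2.trans htn) ha
  have hc2 : c ≤ c ^ 2 := by nlinarith
  have hcm : c * m * 8 ≤ n := by
    refine le_trans ?_ hnbig
    calc c * m * 8 = 16 * (c * m * (1 / 2)) := by ring
      _ ≤ y * (c ^ 2 * m * H) := by gcongr
  -- Bootstrap: the crude `H ≥ 1/2` with `y ≥ 16` gives `n ≥ 8`, hence `H ≥ 1`.
  have hn8 : (8 : ℝ) ≤ n := by nlinarith
  have hH : 1 ≤ H := by
    rw [hHdef, Real.le_log_iff_exp_le (by linarith)]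
    linarith [Real.exp_one_lt_d9]
  have hexpH : Real.exp H = n := Real.exp_log (by linarith)
  have hexpnH : Real.exp (-H) = (n : ℝ)⁻¹ := by rw [Real.exp_neg, hexpH]
  have hmE : 0 < m * E := by positivity
  have hmEn : m * E ≤ n := by nlinarith
  -- the number of blocks
  set L := ⌈2 * n / (m * E)⌉₊ with hL
  have hL1 : 2 * n / (m * E) ≤ L := Nat.le_ceil _
  -- `L` is twice the typical number of blocks, rounded up; `n / (m E) ≥ 1` absorbs the rounding.
  have hL2 : (L : ℝ) ≤ 3 * (n * (m * E)⁻¹) := by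
    have h1 : (L : ℝ) < 2 * n / (m * E) + 1 := Nat.ceil_lt_add_one (by positivity)
    have h2 : 1 ≤ n / (m * E) := by rwa [le_div_iff₀ hmE, one_mul]
    have h3 : 3 * (n * (m * E)⁻¹) = 2 * n / (m * E) + n / (m * E) := by ring
    linarith
  have hL3 : (L : ℝ) ≤ 3 * n := by
    refine hL2.trans ?_
    have : (m * E)⁻¹ ≤ 1 := inv_le_one_of_one_le₀ (by nlinarith)
    nlinarith
  have hcE : y / 2000 ≤ y / 192 := by linarith
  -- the three exceptional events
  have hlog : y * (c * H) / 8 ≤ t / (8 * (a * m)) / c := by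
    rw [div_div, le_div_iff₀ (by positivity)]
    calc y * (c * H) / 8 * (8 * (a * m) * c) = y * (c ^ 2 * a * m * H) := by ring
      _ ≤ t := hy2
  have hA : ∀ k, μ {ω | t / (8 * (a * m)) < (regenTime m R (k + 1) ω : ℝ)} ≤
      ENNReal.ofReal (2 * ((n : ℝ)⁻¹ * Real.exp (-(y / 2000)))) := by
    intro k
    refine (measure_lt_le_of_exp hc0 (fun ω => Nat.cast_nonneg _) (hT k).1 (hT k).2 _).trans
      (ENNReal.ofReal_le_ofReal ?_)
    -- The exponent `y H / 8` is split in two: one half yields the factor `1 / n` that pays for a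
    -- union over `L + 1` blocks, the other the decay in `y`.
    rw [← hexpnH, ← Real.exp_add]
    refine mul_le_mul_of_nonneg_left (Real.exp_le_exp.2 ?_) (by norm_num)
    have h1 : y * (1 * H) / 8 ≤ y * (c * H) / 8 := by gcongr
    have h2 : 16 * H ≤ y * H := by gcongr
    have h3 : y * 1 ≤ y * H := by gcongr
    linarith
  have hB : μ {ω | (regenSum m R (L + 1) ω : ℝ) ≤ L * E / 2} ≤
      ENNReal.ofReal (Real.exp (-(y / 2000))) := by
    refine (h.measure_regenSum_le hc0 hT L).trans (ENNReal.ofReal_le_ofReal ?_)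
    refine Real.exp_le_exp.2 (neg_le_neg ?_)
    -- Combined with `n ≥ y c² m H` this gives decay `y / 8`; here the square of `c`, hence of `τ`,
    -- is consumed.
    have h1 : n / (8 * m * c ^ 2) ≤ L * E ^ 2 / (16 * c ^ 2) := by
      rw [div_le_iff₀ hmE] at hL1
      rw [div_le_div_iff₀ (by positivity) (by positivity)]
      have h2 : (0 : ℝ) ≤ L * (m * E) := by positivity
      calc (n : ℝ) * (16 * c ^ 2) = 2 * n * (8 * c ^ 2) * 1 := by ring
        _ ≤ L * (m * E) * (8 * c ^ 2) * E := by gcongr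
        _ = _ := by ring
    refine le_trans ?_ h1
    rw [le_div_iff₀ (by positivity)]
    refine le_trans ?_ hnbig
    have : y * (c ^ 2 * m * 1) ≤ y * (c ^ 2 * m * H) := by gcongr
    have h4 : 0 ≤ y * (c ^ 2 * m) := by positivity
    nlinarith
  have hD : ∀ ε : ℝ, |ε| = 1 → ∀ q, μ {ω | ∃ k ≤ L, t / 4 <
      ∑ j ∈ Finset.range k, ε * blockSum m R X f (2 * j + q + 1) ω} ≤
      ENNReal.ofReal (490 * Real.exp (-(y / 2000))) := by
    intro ε hε q
    -- With `l = y / (24t)` the linear gain is `y / 96`, the variance costs at most `y / 192` and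
    -- the truncation errors at most `6`. The scale condition holds because `c ≤ c²`.
    have hl : 0 ≤ y / (24 * t) := by positivity
    refine (h.measure_exists_sum_blockSum_gt hm hf ha hfa hc0 (hT 1) h0 hH hl ?_ hε q L _).trans
      (ENNReal.ofReal_le_ofReal ?_)
    · rw [div_mul_eq_mul_div, div_le_one (by positivity)]
      have h1 : y * (c * a * m * H) ≤ y * (c ^ 2 * a * m * H) := by gcongr
      have h2 : 0 ≤ y * (c ^ 2 * a * m * H) := by positivity
      nlinarith
    · have hσ0 : 0 ≤ σ2 := variance_nonneg _ _
      have h1 : (L : ℝ) * ((y / (24 * t)) ^ 2 * σ2) ≤ y / 192 := by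
        calc (L : ℝ) * ((y / (24 * t)) ^ 2 * σ2)
            ≤ 3 * (n * (m * E)⁻¹) * ((y / (24 * t)) ^ 2 * σ2) := by gcongr
          _ = y / (192 * t ^ 2) * (y * (n * (m * E)⁻¹ * σ2)) := by
            field_simp; ring
          _ ≤ y / (192 * t ^ 2) * t ^ 2 := by gcongr
          _ = y / 192 := by field_simp
      have h2 : (L : ℝ) * (2 * Real.exp (-H)) ≤ 6 := by
        rw [hexpnH]
        calc (L : ℝ) * (2 * (n : ℝ)⁻¹) ≤ 3 * n * (2 * (n : ℝ)⁻¹) := by gcongr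
          _ = 6 := by field_simp; norm_num
      have h3 : y / (24 * t) * (t / 4) = y / 96 := by field_simp; norm_num
      have h4 : Real.exp 6 ≤ 490 := by
        have h5 : Real.exp 6 = Real.exp 1 ^ 6 := by rw [← Real.exp_nat_mul]; norm_num
        rw [h5]
        calc Real.exp 1 ^ 6 ≤ 2.7182818286 ^ 6 := by gcongr; exact Real.exp_one_lt_d9.le
          _ ≤ 490 := by norm_num
      calc Real.exp (-(y / (24 * t) * (t / 4)) + L * ((y / (24 * t)) ^ 2 * σ2 + 2 * Real.exp (-H)))
          ≤ Real.exp (6 + -(y / 2000)) := by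
            refine Real.exp_le_exp.2 ?_
            rw [h3, mul_add]
            linarith
        _ = Real.exp 6 * Real.exp (-(y / 2000)) := Real.exp_add _ _
        _ ≤ _ := by gcongr
  have hne : (n : ℝ) / m ≤ L * E / 2 := by
    rw [div_le_iff₀ hmE] at hL1
    rw [div_le_iff₀ (by linarith)]
    linarith
  refine (h.measure_abs_sum_gt_le_add hm ha hfa L hne).trans ?_
  have hexp := Real.exp_pos (-(y / 2000))
  refine (add_le_add (add_le_add (Finset.sum_le_sum fun k _ => hA k) hB)
    (Finset.sum_le_sum fun q _ => add_le_add (hD 1 (by norm_num) q)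
      (hD (-1) (by norm_num) q))).trans ?_
  simp only [Finset.sum_const, Finset.card_range, nsmul_eq_mul]
  rw [← ENNReal.ofReal_natCast, ← ENNReal.ofReal_natCast, ← ENNReal.ofReal_add (by positivity) (by positivity),
    ← ENNReal.ofReal_mul (by positivity), ← ENNReal.ofReal_mul (by positivity),
    ← ENNReal.ofReal_add (by positivity) (by positivity),
    ← ENNReal.ofReal_add (by positivity) (by positivity)]
  -- The constants add up to `8 + 1 + 4 * 490 = 1969`.
  refine ENNReal.ofReal_le_ofReal ?_
  have h1 : ((L + 1 : ℕ) : ℝ) * (2 * ((n : ℝ)⁻¹ * Real.exp (-(y / 2000)))) ≤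
      8 * Real.exp (-(y / 2000)) := by
    push_cast
    calc ((L : ℝ) + 1) * (2 * ((n : ℝ)⁻¹ * Real.exp (-(y / 2000))))
        ≤ (3 * n + n) * (2 * ((n : ℝ)⁻¹ * Real.exp (-(y / 2000)))) := by gcongr; linarith
      _ = _ := by field_simp; norm_num
  push_cast at h1 ⊢
  linarith

end Chain

end RegenChain

/-! ### Uniqueness of the invariant measure. -/

namespace RegenChain

section Uniqueness

variable {S : Type*} [MeasurableSpace S] {P : Kernel S S}

theorem invariant_pow {η : Measure S} (h : Kernel.Invariant P η) (k : ℕ) :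
    Kernel.Invariant (P ^ k) η := by
  induction k with
  | zero => exact Measure.id_comp
  | succ k ih =>
    rw [pow_succ]
    exact ih.comp h

/-- `ρ - η` is the least `ξ` with `ρ ≤ ξ + η`. Applying `P` to that inequality shows that `(ρ - η)P`
is also admissible, so it dominates `ρ - η`; equal total mass forces equality. -/
theorem invariant_sub [IsMarkovKernel P] {ρ η : Measure S} [IsFiniteMeasure ρ] [IsFiniteMeasure η]
    (hρ : Kernel.Invariant P ρ) (hη : Kernel.Invariant P η) : Kernel.Invariant P (ρ - η) := by
  have hle : ρ - η ≤ (ρ - η).bind P := by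
    rw [Measure.sub_le_iff_le_add]
    have h1 : ρ ≤ (ρ - η) + η := Measure.sub_le_iff_le_add.1 le_rfl
    refine Measure.le_iff.2 fun A hA => ?_
    rw [Measure.add_apply, Measure.bind_apply hA P.aemeasurable]
    nth_rewrite 2 [← hη.def]
    rw [← hρ.def, Measure.bind_apply hA P.aemeasurable, Measure.bind_apply hA P.aemeasurable,
      ← lintegral_add_measure]
    rw [hρ.def]
    exact lintegral_mono' h1 le_rfl
  refine (Measure.eq_of_le_of_measure_univ_eq hle ?_).symm
  rw [Measure.bind_apply .univ P.aemeasurable]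
  simp

/-- Accessibility forces `η C > 0`, and integrating the minorization over `C` gives `η A ≥ δ ν(A)
η(C)`. -/
theorem Minorization.absolutelyContinuous {m : ℕ} {δ : ℝ} {C : Set S} {ν η : Measure S}
    (h : Minorization P m δ C ν) (hη : Kernel.Invariant P η) (h0 : η ≠ 0) : ν ≪ η := by
  have hC : η C ≠ 0 := by
    intro hC0
    have hk : ∀ k : ℕ, ∀ᵐ x ∂η, (P ^ (k * m)) x C = 0 := by
      intro k
      have h1 := (invariant_pow hη (k * m)).def
      rw [← h1, Measure.bind_apply h.measurableSet (Kernel.aemeasurable _),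
        lintegral_eq_zero_iff (Kernel.measurable_coe _ h.measurableSet)] at hC0
      exact hC0
    have hfalse : ∀ᵐ _ ∂η, False := by
      filter_upwards [ae_all_iff.2 hk] with x hx
      obtain ⟨k, hk⟩ := h.access x
      exact hk.ne' (hx k)
    exact h0 (by simpa [ae_eq_bot] using hfalse)
  refine Measure.AbsolutelyContinuous.mk fun A hA hA0 => ?_
  have h1 := (invariant_pow hη m).def
  rw [← h1, Measure.bind_apply hA (Kernel.aemeasurable _)] at hA0
  have h2 : ENNReal.ofReal δ * ν A * η C ≤ 0 := by
    rw [← hA0]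
    calc ENNReal.ofReal δ * ν A * η C = ∫⁻ _ in C, ENNReal.ofReal δ * ν A ∂η := by simp
      _ ≤ ∫⁻ x in C, (P ^ m) x A ∂η :=
        setLIntegral_mono (Kernel.measurable_coe _ hA) fun x hx => h.minorize x hx A hA
      _ ≤ _ := setLIntegral_le_lintegral _ _
  have h3 := h.δ_pos
  simpa [hC, not_le.2 h3] using h2

/-- A chain with an accessible small set has, up to normalization, at most one invariant finite
measure. -/
theorem Minorization.invariant_unique [IsMarkovKernel P] {m : ℕ} {δ : ℝ} {C : Set S}
    {ν ρ η : Measure S} (h : Minorization P m δ C ν) [IsFiniteMeasure ρ] [IsFiniteMeasure η]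
    (hρ : Kernel.Invariant P ρ) (hη : Kernel.Invariant P η) (huniv : ρ Set.univ = η Set.univ) :
    ρ = η := by
  have := h.isProbabilityMeasure
  have hle : ∀ {α β : Measure S} [IsFiniteMeasure α] [IsFiniteMeasure β], α - β = 0 → α ≤ β := by
    intro α β _ _ h0
    simpa [h0] using (Measure.sub_le_iff_le_add (μ := α) (ν := β) (ξ := α - β)).1 le_rfl
  by_cases h1 : ρ - η = 0
  · exact Measure.eq_of_le_of_measure_univ_eq (hle h1) huniv
  by_cases h2 : η - ρ = 0
  · exact (Measure.eq_of_le_of_measure_univ_eq (hle h2) huniv.symm).symm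
  -- Both differences would dominate `ν`, yet they are mutually singular.
  have h3 := h.absolutelyContinuous (invariant_sub hρ hη) h1
  have h4 := h.absolutelyContinuous (invariant_sub hη hρ) h2
  have h5 : ν ⟂ₘ ν := (Measure.mutually_singular_measure_sub (μ := ρ) (ν := η)).mono_ac h3 h4
  exact absurd (Measure.MutuallySingular.self_iff ν |>.1 h5) (IsProbabilityMeasure.ne_zero ν)

end Uniqueness

/-! ### The occupation measure of the first full block. -/

section Occupation

variable {Ω S : Type*} {m : ℕ} {X : ℕ → Ω → S} {R : ℕ → Ω → Fin 2}

/-- The event that time `j` belongs to the first full block. -/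
def inFirstBlock (m : ℕ) (R : ℕ → Ω → Fin 2) (j : ℕ) : Set Ω :=
  {ω | j ∈ Finset.Icc (m * (regenSum m R 1 ω + 1)) (m * regenSum m R 2 ω + m - 1)}

theorem tsum_indicator_inFirstBlock (g : S → ℝ) (ω : Ω) :
    ∑' j, (inFirstBlock m R j).indicator (fun ω => g (X j ω)) ω = blockSum m R X g 1 ω := by
  rw [blockSum, tsum_eq_sum (s := Finset.Icc (m * (regenSum m R 1 ω + 1))
    (m * regenSum m R 2 ω + m - 1))]
  · exact Finset.sum_congr rfl fun j hj =>
      Set.indicator_of_mem (show ω ∈ inFirstBlock m R j from hj) _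
  · exact fun j hj => Set.indicator_of_notMem (show ω ∉ inFirstBlock m R j from hj) _

variable [MeasurableSpace Ω] [MeasurableSpace S] {μ : Measure Ω}

/-- The occupation measure of the first full block. -/
noncomputable def occupation (μ : Measure Ω) (m : ℕ) (R : ℕ → Ω → Fin 2) (X : ℕ → Ω → S) :
    Measure S :=
  Measure.sum fun j => (μ.restrict (inFirstBlock m R j)).map (X j)

theorem measurableSet_inFirstBlock (hR : ∀ n, Measurable (R n)) (j : ℕ) :
    MeasurableSet (inFirstBlock m R j) := by
  have h1 := measurable_regenSum (m := m) hR 1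
  have h2 := measurable_regenSum (m := m) hR 2
  exact (h1.prodMk h2) (MeasurableSet.of_discrete (s := {p : ℕ × ℕ |
    j ∈ Finset.Icc (m * (p.1 + 1)) (m * p.2 + m - 1)}))

theorem isFiniteMeasure_occupation (hm : 0 < m) (hX : ∀ n, Measurable (X n))
    (hR : ∀ n, Measurable (R n)) (hi : Integrable (fun ω => (regenTime m R 2 ω : ℝ)) μ) :
    IsFiniteMeasure (occupation μ m R X) := by
  constructor
  have h1 : occupation μ m R X Set.univ =
      ∫⁻ ω, ∑' j, (inFirstBlock m R j).indicator (fun _ => (1 : ℝ≥0∞)) ω ∂μ := by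
    rw [lintegral_tsum fun j => (measurable_const.indicator
      (measurableSet_inFirstBlock hR j)).aemeasurable, occupation, Measure.sum_apply _ .univ]
    refine tsum_congr fun j => ?_
    rw [Measure.map_apply (hX j) .univ, Set.preimage_univ, Measure.restrict_apply .univ,
      Set.univ_inter, lintegral_indicator_const (measurableSet_inFirstBlock hR j), one_mul]
  -- The block length is written as the block sum of the constant `1` along a chain on one point, so
  -- that the bound by `m T₂` can be reused.
  have h2 : ∀ ω, ∑' j, (inFirstBlock m R j).indicator (fun _ => (1 : ℝ≥0∞)) ω =
      ENNReal.ofReal (blockSum m R (fun _ _ => ()) (fun _ => 1) 1 ω) := by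
    intro ω
    rw [tsum_eq_sum (s := Finset.Icc (m * (regenSum m R 1 ω + 1))
      (m * regenSum m R 2 ω + m - 1)), blockSum, ENNReal.ofReal_sum_of_nonneg (by simp)]
    · refine Finset.sum_congr rfl fun j hj => ?_
      rw [Set.indicator_of_mem (show ω ∈ inFirstBlock m R j from hj)]
      simp
    · exact fun j hj => Set.indicator_of_notMem (show ω ∉ inFirstBlock m R j from hj) _
  rw [h1]
  calc ∫⁻ ω, ∑' j, (inFirstBlock m R j).indicator (fun _ => (1 : ℝ≥0∞)) ω ∂μ
      ≤ ∫⁻ ω, ENNReal.ofReal (m * regenTime m R 2 ω) ∂μ := by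
        refine lintegral_mono fun ω => ?_
        rw [h2]
        refine ENNReal.ofReal_le_ofReal ((le_abs_self _).trans ?_)
        simpa using abs_blockSum_le (m := m) (R := R) (ω := ω) hm (X := fun _ _ => ())
          (f := fun _ => (1 : ℝ)) (a := 1) (by simp) 1
    _ < ∞ := (hi.const_mul _).lintegral_lt_top

theorem integral_occupation (hX : ∀ n, Measurable (X n)) (hR : ∀ n, Measurable (R n))
    [IsFiniteMeasure (occupation μ m R X)] {g : S → ℝ} (hg : Measurable g) {a : ℝ}
    (hga : ∀ x, |g x| ≤ a) :
    ∫ x, g x ∂(occupation μ m R X) = ∫ ω, blockSum m R X g 1 ω ∂μ := by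
  have hgi : Integrable g (occupation μ m R X) :=
    Integrable.of_bound hg.aestronglyMeasurable a (Filter.Eventually.of_forall hga)
  have h1 : ∀ j, ∫ x, g x ∂((μ.restrict (inFirstBlock m R j)).map (X j)) =
      ∫ ω, (inFirstBlock m R j).indicator (fun ω => g (X j ω)) ω ∂μ := by
    intro j
    rw [integral_map (hX j).aemeasurable hg.aestronglyMeasurable,
      integral_indicator (measurableSet_inFirstBlock hR j)]
  have hfin : ∑' j, ∫⁻ ω, ‖(inFirstBlock m R j).indicator (fun ω => g (X j ω)) ω‖ₑ ∂μ ≠ ∞ := by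
    have h2 := hgi.hasFiniteIntegral
    rw [HasFiniteIntegral, occupation, lintegral_sum_measure] at h2
    refine ne_of_lt (lt_of_eq_of_lt (tsum_congr fun j => ?_) h2)
    rw [lintegral_map hg.enorm (hX j), ← lintegral_indicator (measurableSet_inFirstBlock hR j)]
    refine lintegral_congr fun ω => ?_
    rw [enorm_indicator_eq_indicator_enorm]
  calc ∫ x, g x ∂(occupation μ m R X)
      = ∑' j, ∫ ω, (inFirstBlock m R j).indicator (fun ω => g (X j ω)) ω ∂μ := by
        rw [occupation, integral_sum_measure hgi]
        exact tsum_congr h1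
    _ = ∫ ω, ∑' j, (inFirstBlock m R j).indicator (fun ω => g (X j ω)) ω ∂μ :=
        (integral_tsum (fun j => ((hg.comp (hX j)).indicator
          (measurableSet_inFirstBlock hR j)).aestronglyMeasurable) hfin).symm
    _ = _ := integral_congr_ae (Filter.Eventually.of_forall fun ω =>
        tsum_indicator_inFirstBlock g ω)

end Occupation

end RegenChain

/-! ### Invariance of the occupation measure and centring of block sums. -/

namespace RegenChain

section Centering

variable {Ω S : Type*} [MeasurableSpace Ω] [MeasurableSpace S] {μ : Measure Ω}
  {P : Kernel S S} {m : ℕ} {X : ℕ → Ω → S} {R : ℕ → Ω → Fin 2} [IsProbabilityMeasure μ]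

theorem integral_abs_le_add_measureReal {Y : Ω → ℝ} (hY : Measurable Y) {b s : ℝ} (hs : 0 ≤ s)
    (hYb : ∀ ω, |Y ω| ≤ b) : |∫ ω, Y ω ∂μ| ≤ s + b * μ.real {ω | s < |Y ω|} := by
  have hA : MeasurableSet {ω | s < |Y ω|} := measurableSet_lt measurable_const hY.abs
  have hind : Integrable ({ω | s < |Y ω|}.indicator fun _ => b) μ :=
    (integrable_const b).indicator hA
  calc |∫ ω, Y ω ∂μ| ≤ ∫ ω, |Y ω| ∂μ := abs_integral_le_integral_abs
    _ ≤ ∫ ω, (s + {ω | s < |Y ω|}.indicator (fun _ => b) ω) ∂μ := by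
      refine integral_mono (Integrable.of_bound hY.abs.aestronglyMeasurable b
        (Filter.Eventually.of_forall fun ω => by simpa using hYb ω))
        ((integrable_const s).add hind) fun ω => ?_
      by_cases hω : ω ∈ {ω | s < |Y ω|}
      · simp only [Set.indicator_of_mem hω]
        linarith [hYb ω]
      · simp only [Set.indicator_of_notMem hω, add_zero]
        exact not_lt.1 hω
    _ = s + b * μ.real {ω | s < |Y ω|} := by
      rw [integral_add (integrable_const s) hind, integral_indicator_const _ hA]
      simp [mul_comm]

/-- Fix `y` so large that the tail is negligible even after multiplication by `a`. At level `n η /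
2` both constraints on `y` hold eventually, since `n` and `log n` are negligible against `n²` and
`n`. -/
theorem IsRegenerative.tendsto_mean (h : IsRegenerative μ P m X R) (hm : 0 < m)
    {c : ℝ} (hc : 1 ≤ c)
    (hT : ∀ i, Integrable (fun ω => Real.exp (|(regenTime m R (i + 1) ω : ℝ)| / c)) μ ∧
      ∫ ω, Real.exp (|(regenTime m R (i + 1) ω : ℝ)| / c) ∂μ ≤ 2)
    {f : S → ℝ} (hf : Measurable f) {a : ℝ} (ha : 0 < a) (hfa : ∀ x, |f x| ≤ a)
    (h0 : ∫ ω, blockSum m R X f 1 ω ∂μ = 0) :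
    Filter.Tendsto (fun n : ℕ => (n : ℝ)⁻¹ * ∫ ω, ∑ i ∈ Finset.Icc 1 n, f (X i ω) ∂μ)
      Filter.atTop (nhds 0) := by
  rw [Metric.tendsto_atTop']
  intro η hη
  obtain ⟨y, hy⟩ : ∃ y : ℝ, a * (2000 * Real.exp (-(y / 2000))) < η / 2 := by
    have h1 : Filter.Tendsto (fun y : ℝ => a * (2000 * Real.exp (-(y / 2000)))) Filter.atTop
        (nhds (a * (2000 * 0))) :=
      ((Real.tendsto_exp_neg_atTop_nhds_zero.comp
        (Filter.tendsto_id.atTop_div_const (by norm_num : (0 : ℝ) < 2000))).const_mul _).const_mul _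
    rw [mul_zero, mul_zero] at h1
    exact (h1.eventually (gt_mem_nhds (half_pos hη))).exists
  set v := (m * ∫ ω, (regenTime m R 2 ω : ℝ) ∂μ)⁻¹ * Var[blockSum m R X f 1; μ] with hv
  have hcast := tendsto_natCast_atTop_atTop (R := ℝ)
  have e1 : ∀ᶠ n : ℕ in Filter.atTop, y * v / (η / 2) ^ 2 ≤ n :=
    hcast.eventually (Filter.eventually_ge_atTop _)
  have e2 : ∀ᶠ n : ℕ in Filter.atTop,
      ‖y * (c ^ 2 * a * m) * Real.log n‖ ≤ η / 2 * ‖(n : ℝ)‖ :=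
    ((Real.isLittleO_log_id_atTop.comp_tendsto hcast).const_mul_left _).def (half_pos hη)
  obtain ⟨N, hN⟩ := Filter.eventually_atTop.1
    ((e1.and e2).and (Filter.eventually_ge_atTop 2))
  refine ⟨N, fun n hn => ?_⟩
  obtain ⟨⟨hn1, hn2⟩, hn3⟩ := hN n hn.le
  have hnR : (0 : ℝ) < n := by exact_mod_cast (by omega : 0 < n)
  set Y : Ω → ℝ := fun ω => ∑ i ∈ Finset.Icc 1 n, f (X i ω) with hY
  have hYm : Measurable Y := Finset.measurable_sum _ fun i _ => hf.comp (h.isMarkovChain.measurable i)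
  have hYb : ∀ ω, |Y ω| ≤ n * a := by
    intro ω
    refine (Finset.abs_sum_le_sum_abs _ _).trans
      ((Finset.sum_le_card_nsmul _ _ a fun j _ => hfa _).trans ?_)
    simp
  have htail := h.measure_abs_sum_gt_le hm hc hT hf ha hfa h0 hn3 (t := n * (η / 2)) (y := y)
    (by positivity) (by
      rw [div_le_iff₀ (by positivity)] at hn1
      rw [mul_assoc (n : ℝ), ← hv]
      calc y * (n * v) = n * (y * v) := by ring
        _ ≤ n * (n * (η / 2) ^ 2) := by gcongr
        _ = _ := by ring) (by
      rw [Real.norm_eq_abs, Real.norm_eq_abs, abs_of_pos hnR] at hn2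
      have := (le_abs_self _).trans hn2
      linarith)
  have htail' : μ.real {ω | n * (η / 2) < |Y ω|} ≤ 2000 * Real.exp (-(y / 2000)) :=
    ENNReal.toReal_le_of_le_ofReal (by positivity) htail
  have hmain := integral_abs_le_add_measureReal (μ := μ) hYm (s := n * (η / 2)) (by positivity) hYb
  rw [dist_zero_right, Real.norm_eq_abs, abs_mul, abs_of_pos (inv_pos.2 hnR),
    inv_mul_lt_iff₀ hnR]
  calc |∫ ω, Y ω ∂μ| ≤ n * (η / 2) + n * a * (2000 * Real.exp (-(y / 2000))) :=
        hmain.trans (by gcongr)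
    _ = n * (η / 2 + a * (2000 * Real.exp (-(y / 2000)))) := by ring
    _ < n * η := by gcongr; linarith

theorem IsMarkovChain.integral_kernel (h : IsMarkovChain μ P X) {A : Set S}
    (hA : MeasurableSet A) {n : ℕ} (hn : 1 ≤ n) :
    ∫ ω, (P (X n ω)).real A ∂μ = μ.real (X (n + 1) ⁻¹' A) := by
  rw [← integral_congr_ae (h.markov n hn A hA), integral_condExp
    (iSup₂_le fun i _ => (h.measurable i).comap_le),
    integral_indicator_const _ (h.measurable _ hA)]
  simp

/-- Invariance on `A` says that `P 1_A` and `1_A` have block sums of equal mean. Long time averages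
detect any discrepancy, and the Markov property makes them telescope. -/
theorem IsRegenerative.invariant_occupation [IsMarkovKernel P] (h : IsRegenerative μ P m X R)
    (hm : 0 < m) {c : ℝ} (hc : 1 ≤ c)
    (hT : ∀ i, Integrable (fun ω => Real.exp (|(regenTime m R (i + 1) ω : ℝ)| / c)) μ ∧
      ∫ ω, Real.exp (|(regenTime m R (i + 1) ω : ℝ)| / c) ∂μ ≤ 2) :
    Kernel.Invariant P (occupation μ m R X) := by
  have hX := h.isMarkovChain.measurable
  have hR := h.measurable_R
  have hmR : (0 : ℝ) < m := by exact_mod_cast hm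
  have hTi : Integrable (fun ω => (regenTime m R 2 ω : ℝ)) μ :=
    integrable_of_exp (by linarith) ((measurable_of_countable fun k : ℕ => (k : ℝ)).comp
      (measurable_regenTime hR 2)).aemeasurable (hT 1).1
  have hE := h.one_le_integral_regenTime hTi
  set E := ∫ ω, (regenTime m R 2 ω : ℝ) ∂μ with hEdef
  have := isFiniteMeasure_occupation hm hX hR hTi
  refine Measure.ext fun A hA => ?_
  rw [Measure.bind_apply hA P.aemeasurable]
  set g1 : S → ℝ := A.indicator fun _ => 1 with hg1
  set g2 : S → ℝ := fun x => (P x).real A with hg2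
  have hg1m : Measurable g1 := measurable_const.indicator hA
  have hg2m : Measurable g2 := (Kernel.measurable_coe P hA).ennreal_toReal
  have hg1b : ∀ x, |g1 x| ≤ 1 := by
    intro x
    by_cases hx : x ∈ A <;> simp [hg1, hx]
  have hg2b : ∀ x, |g2 x| ≤ 1 := fun x => by
    rw [hg2, abs_of_nonneg measureReal_nonneg]
    exact measureReal_le_one
  have hZi : ∀ {g : S → ℝ}, Measurable g → (∀ x, |g x| ≤ 1) →
      Integrable (blockSum m R X g 1) μ := by
    intro g hg hgb
    refine (hTi.const_mul (1 * m)).mono' (h.measurable_blockSum hg 0).aestronglyMeasurable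
      (Filter.Eventually.of_forall fun ω => ?_)
    exact abs_blockSum_le hm hgb 1
  -- A constant `r` contributes `r m T₂` to the block sum, so this choice centres it.
  set r := (∫ ω, blockSum m R X g2 1 ω ∂μ - ∫ ω, blockSum m R X g1 1 ω ∂μ) / (m * E) with hr
  set f : S → ℝ := fun x => g2 x - g1 x - r with hf
  have hf0 : ∫ ω, blockSum m R X f 1 ω ∂μ = 0 := by
    have h1 : ∀ ω, blockSum m R X f 1 ω =
        blockSum m R X g2 1 ω - blockSum m R X g1 1 ω - r * m * regenTime m R 2 ω := by
      intro ω
      have h2 := blockSum_sub m R X (fun x => g2 x - g1 x) (fun _ => r) 1 ω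
      rw [blockSum_sub m R X g2 g1, blockSum_const hm] at h2
      rw [hf, h2]
      ring
    simp only [h1]
    have h21 : Integrable (fun ω => blockSum m R X g2 1 ω - blockSum m R X g1 1 ω) μ :=
      (hZi hg2m hg2b).sub (hZi hg1m hg1b)
    rw [integral_sub h21 (hTi.const_mul _), integral_sub (hZi hg2m hg2b) (hZi hg1m hg1b),
      integral_const_mul, ← hEdef, hr]
    field_simp
    ring
  have hlim := h.tendsto_mean hm hc hT (f := f) ((hg2m.sub hg1m).sub_const r) (a := 2 + |r|)
    (by positivity) (fun x => by
      have h1 := abs_sub (g2 x - g1 x) r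
      have h2 := abs_sub (g2 x) (g1 x)
      have h3 := hg1b x
      have h4 := hg2b x
      simp only [hf]
      linarith) hf0
  have hmean : ∀ n : ℕ, ∫ ω, ∑ i ∈ Finset.Icc 1 n, f (X i ω) ∂μ =
      (∫ ω, g1 (X (n + 1) ω) ∂μ - ∫ ω, g1 (X 1 ω) ∂μ) - n * r := by
    have hi1 : ∀ i, Integrable (fun ω => g1 (X i ω)) μ := fun i =>
      Integrable.of_bound (hg1m.comp (hX i)).aestronglyMeasurable 1
        (Filter.Eventually.of_forall fun ω => hg1b _)
    have hi2 : ∀ i, Integrable (fun ω => g2 (X i ω)) μ := fun i =>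
      Integrable.of_bound (hg2m.comp (hX i)).aestronglyMeasurable 1
        (Filter.Eventually.of_forall fun ω => hg2b _)
    have hi21 : ∀ i, Integrable (fun ω => g2 (X i ω) - g1 (X i ω)) μ := fun i =>
      (hi2 i).sub (hi1 i)
    have hi : ∀ i, Integrable (fun ω => f (X i ω)) μ := fun i =>
      (hi21 i).sub (integrable_const r)
    intro n
    rw [integral_finsetSum _ fun i _ => hi i]
    induction n with
    | zero => simp
    | succ n ih =>
      rw [Finset.sum_Icc_succ_top (by omega), ih]
      have h1 : ∫ ω, g2 (X (n + 1) ω) ∂μ = ∫ ω, g1 (X (n + 1 + 1) ω) ∂μ := by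
        rw [hg2, h.isMarkovChain.integral_kernel hA (by omega)]
        have h2 : (fun ω => g1 (X (n + 1 + 1) ω)) =
            (X (n + 1 + 1) ⁻¹' A).indicator fun _ => (1 : ℝ) := rfl
        rw [h2, integral_indicator_const _ (hX _ hA)]
        simp
      have h3 : ∫ ω, f (X (n + 1) ω) ∂μ =
          ∫ ω, g2 (X (n + 1) ω) ∂μ - ∫ ω, g1 (X (n + 1) ω) ∂μ - r := by
        simp only [hf]
        rw [integral_sub (hi21 _) (integrable_const r), integral_sub (hi2 _) (hi1 _)]
        simp
      rw [h3, h1]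
      push_cast
      ring
  have hr0 : r = 0 := by
    have hbd : ∀ i, |∫ ω, g1 (X i ω) ∂μ| ≤ 1 := fun i => by
      have := norm_integral_le_of_norm_le_const (μ := μ) (f := fun ω => g1 (X i ω)) (C := 1)
        (Filter.Eventually.of_forall fun ω => hg1b _)
      simpa using this
    have hlim2 : Filter.Tendsto (fun n : ℕ => (n : ℝ)⁻¹ * 2) Filter.atTop (nhds (0 * 2)) :=
      tendsto_inv_atTop_nhds_zero_nat.mul_const 2
    have hlim3 : Filter.Tendsto (fun n : ℕ => |(n : ℝ)⁻¹ *
        ∫ ω, ∑ i ∈ Finset.Icc 1 n, f (X i ω) ∂μ| + (n : ℝ)⁻¹ * 2) Filter.atTop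
        (nhds (|0| + 0 * 2)) := hlim.abs.add hlim2
    have hle : |r| ≤ |0| + 0 * 2 := by
      refine le_of_tendsto_of_tendsto tendsto_const_nhds hlim3 ?_
      filter_upwards [Filter.eventually_gt_atTop 0] with n hn
      have hnR : (0 : ℝ) < n := by exact_mod_cast hn
      set d := ∫ ω, g1 (X (n + 1) ω) ∂μ - ∫ ω, g1 (X 1 ω) ∂μ with hd
      have hd2 : |d| ≤ 2 := by
        have := abs_sub (∫ ω, g1 (X (n + 1) ω) ∂μ) (∫ ω, g1 (X 1 ω) ∂μ)
        linarith [hbd (n + 1), hbd 1]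
      have e1 : r = (n : ℝ)⁻¹ * d - (n : ℝ)⁻¹ * ∫ ω, ∑ i ∈ Finset.Icc 1 n, f (X i ω) ∂μ := by
        rw [hmean, ← hd]
        field_simp
        ring
      have e2 := abs_sub ((n : ℝ)⁻¹ * d) ((n : ℝ)⁻¹ * ∫ ω, ∑ i ∈ Finset.Icc 1 n, f (X i ω) ∂μ)
      rw [← e1, abs_mul, abs_of_pos (inv_pos.2 hnR)] at e2
      have e3 : (n : ℝ)⁻¹ * |d| ≤ (n : ℝ)⁻¹ * 2 := by gcongr
      linarith
    simpa using hle
  have hZ : ∫ ω, blockSum m R X g2 1 ω ∂μ = ∫ ω, blockSum m R X g1 1 ω ∂μ := by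
    rw [hr, div_eq_zero_iff] at hr0
    rcases hr0 with h1 | h1
    · exact sub_eq_zero.1 h1
    · exact absurd h1 (by positivity)
  rw [← integral_occupation hX hR hg2m hg2b, ← integral_occupation hX hR hg1m hg1b, hg1,
    integral_indicator_const _ hA, smul_eq_mul, mul_one] at hZ
  have h1 : ∫⁻ x, P x A ∂(occupation μ m R X) =
      ENNReal.ofReal (∫ x, g2 x ∂(occupation μ m R X)) := by
    rw [ofReal_integral_eq_lintegral_ofReal (Integrable.of_bound hg2m.aestronglyMeasurable 1
      (Filter.Eventually.of_forall hg2b)) (Filter.Eventually.of_forall fun x => measureReal_nonneg)]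
    exact lintegral_congr fun x => (ofReal_measureReal).symm
  rw [h1, hZ, ofReal_measureReal]

/-- Pitman's occupation formula in the centred case. -/
theorem IsRegenerative.integral_blockSum_eq_zero [IsMarkovKernel P]
    (h : IsRegenerative μ P m X R) {δ : ℝ} {C : Set S} {ν π : Measure S}
    [IsProbabilityMeasure π] (hmin : Minorization P m δ C ν) (hπ : Kernel.Invariant P π)
    {c : ℝ} (hc : 1 ≤ c)
    (hT : ∀ i, Integrable (fun ω => Real.exp (|(regenTime m R (i + 1) ω : ℝ)| / c)) μ ∧
      ∫ ω, Real.exp (|(regenTime m R (i + 1) ω : ℝ)| / c) ∂μ ≤ 2)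
    {f : S → ℝ} (hf : Measurable f) {a : ℝ} (hfa : ∀ x, |f x| ≤ a) (hf0 : ∫ x, f x ∂π = 0) :
    ∫ ω, blockSum m R X f 1 ω ∂μ = 0 := by
  have hX := h.isMarkovChain.measurable
  have hR := h.measurable_R
  have hTi : Integrable (fun ω => (regenTime m R 2 ω : ℝ)) μ :=
    integrable_of_exp (by linarith) ((measurable_of_countable fun k : ℕ => (k : ℝ)).comp
      (measurable_regenTime hR 2)).aemeasurable (hT 1).1
  have := isFiniteMeasure_occupation hmin.m_pos hX hR hTi
  set ρ := occupation μ m R X with hρdef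
  have hρ : Kernel.Invariant P ρ := h.invariant_occupation hmin.m_pos hc hT
  have hsmul : Kernel.Invariant P (ρ Set.univ • π) := by
    refine Measure.ext fun A hA => ?_
    rw [Measure.bind_apply hA P.aemeasurable, lintegral_smul_measure,
      ← Measure.bind_apply hA P.aemeasurable, hπ.def]
    rfl
  have hfin : IsFiniteMeasure (ρ Set.univ • π) := π.smul_finite (measure_ne_top ρ _)
  -- The multiple of `π` is normalized to the mass of `ρ`, as uniqueness compares measures of equal
  -- mass.
  have heq : ρ = ρ Set.univ • π := hmin.invariant_unique hρ hsmul (by simp)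
  rw [← integral_occupation hX hR hf hfa, ← hρdef, heq, integral_smul_measure, hf0, smul_zero]

end Centering

/-! ### From the Orlicz norm to exponential moments. -/

section OrliczNorm

variable {Ω : Type*} [MeasurableSpace Ω] {μ : Measure Ω} {T : Ω → ℝ}

theorem exists_of_psiOneNorm_lt {r : ℝ≥0∞} (h : psiOneNorm μ T < r) :
    ∃ c : ℝ, 0 < c ∧ ENNReal.ofReal c < r ∧
      ∫⁻ ω, ENNReal.ofReal (Real.exp (|T ω| / c) - 1) ∂μ ≤ 1 := by
  obtain ⟨_, ⟨c, hc, rfl, hle⟩, hlt⟩ := sInf_lt_iff.1 h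
  exact ⟨c, hc, hlt, hle⟩

variable [IsProbabilityMeasure μ]

/-- Strictness supplies an admissible scale below `c`, and the defining integral decreases in the
scale; attainment of the infimum is not needed. -/
theorem exp_of_psiOneNorm_lt (hT : Measurable T) {c : ℝ}
    (h : psiOneNorm μ T < ENNReal.ofReal c) :
    Integrable (fun ω => Real.exp (|T ω| / c)) μ ∧ ∫ ω, Real.exp (|T ω| / c) ∂μ ≤ 2 := by
  obtain ⟨d, hd, hdc, hle⟩ := exists_of_psiOneNorm_lt h
  have hdc' : d ≤ c := (ENNReal.ofReal_lt_ofReal_iff_of_nonneg hd.le |>.1 hdc).le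
  have hpt : ∀ ω, ENNReal.ofReal (Real.exp (|T ω| / c) - 1) ≤
      ENNReal.ofReal (Real.exp (|T ω| / d) - 1) := fun ω => by gcongr
  have hle' := (lintegral_mono hpt).trans hle
  have h0 : ∀ ω, 0 ≤ Real.exp (|T ω| / c) - 1 := fun ω => by
    have : 0 ≤ |T ω| / c := div_nonneg (abs_nonneg _) (hd.le.trans hdc')
    linarith [Real.add_one_le_exp (|T ω| / c)]
  have hm : Measurable fun ω => Real.exp (|T ω| / c) - 1 := by fun_prop
  have hi : Integrable (fun ω => Real.exp (|T ω| / c) - 1) μ := by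
    refine ⟨hm.aestronglyMeasurable, ?_⟩
    rw [hasFiniteIntegral_iff_ofReal (Filter.Eventually.of_forall h0)]
    exact hle'.trans_lt ENNReal.one_lt_top
  have hi' : Integrable (fun ω => Real.exp (|T ω| / c)) μ := by
    exact (hi.add (integrable_const (1 : ℝ))).congr (Filter.Eventually.of_forall fun ω => by simp)
  refine ⟨hi', ?_⟩
  have h1 : ∫ ω, (Real.exp (|T ω| / c) - 1) ∂μ ≤ 1 := by
    rw [integral_eq_lintegral_of_nonneg_ae (Filter.Eventually.of_forall h0)
      hm.aestronglyMeasurable]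
    exact ENNReal.toReal_le_of_le_ofReal zero_le_one (by simpa using hle')
  rw [integral_sub hi' (integrable_const 1)] at h1
  simp only [integral_const, probReal_univ, smul_eq_mul] at h1
  linarith

/-- A variable that is at least one has `ψ₁`-norm at least one. -/
theorem one_le_psiOneNorm (hT : ∀ᵐ ω ∂μ, 1 ≤ T ω) : 1 ≤ psiOneNorm μ T := by
  by_contra hcon
  obtain ⟨c, hc, hc1, hle⟩ := exists_of_psiOneNorm_lt (not_le.1 hcon)
  have hc1' : c < 1 := by simpa using hc1
  have h1 : ENNReal.ofReal (Real.exp (1 / c) - 1) ≤ 1 := by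
    calc ENNReal.ofReal (Real.exp (1 / c) - 1)
        = ∫⁻ _, ENNReal.ofReal (Real.exp (1 / c) - 1) ∂μ := by simp
      _ ≤ ∫⁻ ω, ENNReal.ofReal (Real.exp (|T ω| / c) - 1) ∂μ := by
        refine lintegral_mono_ae ?_
        filter_upwards [hT] with ω hω
        have := hω.trans (le_abs_self _)
        gcongr
      _ ≤ 1 := hle
  rw [ENNReal.ofReal_le_one] at h1
  have h2 : 1 < 1 / c := by rwa [lt_div_iff₀ hc, one_mul]
  have := Real.add_one_lt_exp (x := 1 / c) (by positivity)
  linarith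

end OrliczNorm

end RegenChain

/-! ### Extended-valued exponents and conclusion. -/

namespace RegenChain

/-- A real tail bound valid for all admissible exponents turns into one with `tailExponent`. -/
theorem ofReal_exp_le_of_tailExponent {t v b K : ℝ} (ht : 0 < t) (hv : 0 ≤ v) (hb : 0 < b)
    (hK : 0 < K) : ∃ y : ℝ, 0 ≤ y ∧ y * v ≤ t ^ 2 ∧ y * b ≤ t ∧
      EReal.exp (-(((ENNReal.ofReal K)⁻¹ * tailExponent t v b : ℝ≥0∞) : EReal)) =
        ENNReal.ofReal (Real.exp (-(y / K))) := by
  -- `b > 0` keeps the minimum finite even when the variance vanishes, so its real value can serve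
  -- as `y`.
  have hfin : tailExponent t v b ≠ ∞ := by
    refine ne_top_of_le_ne_top ?_ (min_le_right _ _)
    exact ENNReal.div_ne_top ENNReal.ofReal_ne_top (by simpa using hb)
  set y := (tailExponent t v b).toReal with hy
  have hyt : ENNReal.ofReal y = tailExponent t v b := ENNReal.ofReal_toReal hfin
  have hy0 : 0 ≤ y := ENNReal.toReal_nonneg
  have key : ∀ {u w : ℝ}, 0 ≤ u → 0 ≤ w →
      ENNReal.ofReal y ≤ ENNReal.ofReal u / ENNReal.ofReal w → y * w ≤ u := by
    intro u w hu hw h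
    have := ENNReal.mul_le_of_le_div h
    rwa [← ENNReal.ofReal_mul hy0, ENNReal.ofReal_le_ofReal_iff hu] at this
  refine ⟨y, hy0, key (sq_nonneg t) hv (hyt ▸ min_le_left _ _),
    key ht.le hb.le (hyt ▸ min_le_right _ _), ?_⟩
  rw [← hyt, ← ENNReal.ofReal_inv_of_pos hK, ← ENNReal.ofReal_mul (inv_pos.2 hK).le,
    EReal.coe_ennreal_ofReal, max_eq_left (by positivity), ← EReal.coe_neg, EReal.exp_coe]
  congr 3
  ring

end RegenChain

theorem theorem3p1 :
    ∃ K : ℝ, 0 < K ∧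
      ∀ (Ω : Type*) [MeasurableSpace Ω] (μ : Measure Ω) [IsProbabilityMeasure μ]
        (S : Type*) [MeasurableSpace S] (P : Kernel S S) [IsMarkovKernel P]
        (m : ℕ) (δ : ℝ) (C : Set S) (ν : Measure S) (π : Measure S) [IsProbabilityMeasure π]
        (X : ℕ → Ω → S) (R : ℕ → Ω → Fin 2) (τ a : ℝ) (f : S → ℝ) (n : ℕ) (t : ℝ),
        RegenChain.Minorization P m δ C ν →
        Kernel.Invariant P π →
        RegenChain.IsRegenerative μ P m X R →
        RegenChain.psiOneNorm μ (fun ω => (RegenChain.regenTime m R 1 ω : ℝ)) ≤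
          ENNReal.ofReal τ →
        RegenChain.psiOneNorm μ (fun ω => (RegenChain.regenTime m R 2 ω : ℝ)) ≤
          ENNReal.ofReal τ →
        Measurable f →
        (∀ x, |f x| ≤ a) →
        ∫ x, f x ∂π = 0 →
        2 ≤ n →
        0 < t →
        μ {ω | t < |∑ i ∈ Finset.Icc 1 n, f (X i ω)|} ≤
          ENNReal.ofReal K * EReal.exp (-(((ENNReal.ofReal K)⁻¹ *
            RegenChain.tailExponent t
              (n * (m * ∫ ω, (RegenChain.regenTime m R 2 ω : ℝ) ∂μ)⁻¹ *
                Var[RegenChain.blockSum m R X f 1; μ])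
              (τ ^ 2 * a * m * Real.log n) : ℝ≥0∞) : EReal)) := by
  open RegenChain in
  refine ⟨8000, by norm_num, ?_⟩
  intro Ω _ μ _ S _ P _ m δ C ν π _ X R τ a f n t hmin hπ h hT1 hT2 hf hfa hf0 hn ht
  have hm := hmin.m_pos
  have hmR : (0 : ℝ) < m := by exact_mod_cast hm
  have hTm : ∀ i, Measurable fun ω => (regenTime m R i ω : ℝ) := fun i =>
    (measurable_of_countable fun k : ℕ => (k : ℝ)).comp (measurable_regenTime h.measurable_R i)
  have hτ : 1 ≤ τ := by
    have h1 : (1 : ℝ≥0∞) ≤ ENNReal.ofReal τ := by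
      refine (one_le_psiOneNorm ?_).trans hT1
      filter_upwards [h.wellDefined] with ω hω
      exact_mod_cast regenTime_pos hω 0
    simpa using h1
  -- Doubling `τ` creates the strict inequality needed for exponential moments; `τ ≥ 1` because the
  -- times are at least one.
  have hlt : ENNReal.ofReal τ < ENNReal.ofReal (2 * τ) := by
    rw [ENNReal.ofReal_lt_ofReal_iff (by linarith)]
    linarith
  have hT := h.exp_regenTime (exp_of_psiOneNorm_lt (hTm 1) (hT1.trans_lt hlt))
    (exp_of_psiOneNorm_lt (hTm 2) (hT2.trans_lt hlt))
  obtain ⟨ω₀⟩ : Nonempty Ω := nonempty_of_isProbabilityMeasure μ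
  have ha : 0 ≤ a := (abs_nonneg _).trans (hfa (X 0 ω₀))
  -- If `a = 0` then `f` vanishes; this removes the case of an infinite exponent.
  rcases ha.eq_or_lt with rfl | ha
  · have hf00 : ∀ x, f x = 0 := fun x => abs_nonpos_iff.1 (hfa x)
    simp [hf00, ht.le.not_gt]
  have hlog : 0 < Real.log n := Real.log_pos (by exact_mod_cast (by omega : 1 < n))
  have hE : 0 ≤ ∫ ω, (regenTime m R 2 ω : ℝ) ∂μ := integral_nonneg fun ω => Nat.cast_nonneg _
  have hvar := variance_nonneg (blockSum m R X f 1) μ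
  have hc : 1 ≤ 2 * τ := by linarith
  obtain ⟨y, hy0, hy1, hy2, hy3⟩ := ofReal_exp_le_of_tailExponent (K := 8000) ht
    (by positivity : 0 ≤ n * (m * ∫ ω, (regenTime m R 2 ω : ℝ) ∂μ)⁻¹ *
      Var[blockSum m R X f 1; μ])
    (by positivity : 0 < τ ^ 2 * a * m * Real.log n) (by norm_num)
  rw [hy3, ← ENNReal.ofReal_mul (by norm_num)]
  -- Since `c² = 4τ²` for `c = 2τ`, the exponent `y` is replaced by `y / 4`, whence `8000 = 4 *
  -- 2000`.
  refine (h.measure_abs_sum_gt_le hm hc hT hf ha hfa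
    (h.integral_blockSum_eq_zero hmin hπ hc hT hf hfa hf0) hn ht (y := y / 4) ?_ ?_).trans
    (ENNReal.ofReal_le_ofReal ?_)
  · refine le_trans ?_ hy1
    gcongr
    linarith
  · refine le_trans (le_of_eq ?_) hy2
    ring
  · have e : y / 4 / 2000 = y / 8000 := by ring
    rw [e]
    gcongr
    norm_num
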